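/- Let $q\in\mathbb C$, $|q|<1$. Write $(a;q)_n=\prod_{k=0}^{n-1}(1-aq^k)$, $(a;q)_\infty=\prod_{k\ge 0}(1-aq^k)$, $(a,b;q)_\infty=(a;q)_\infty(b;q)_\infty$, and $\genfrac{[}{]}{0pt}{}{n}{j}_q=\frac{(q;q)_n}{(q;q)_j(q;q)_{n-j}}$ for $0\le j\le n$, and $0$ for all other integers $j$. Let $$S^*_n(x,y;q)=\sum_{k=0}^{n}\genfrac{[}{]}{0pt}{}{n}{k}_q q^{k^2}x^{n-k}y^k,$$ $${}_1\phi_2\!\left(\begin{array}{c}a\\ b,c\end{array};q,w\right)=\sum_{n\ge 0}\frac{(a;q)_n}{(q;q)_n(b;q)_n(c;q)_n}\Big[(-1)^nq^{\binom n2}\Big]^{2}w^n,$$ and let $a_0(q)=1$, $b_0(q)=0$ and, for $k\ge 1$, $$a_k(q)=\sum_{i\in\mathbb Z}(-1)^iq^{i(5i-3)/2}\genfrac{[}{]}{0pt}{}{k-1}{\lfloor (k+1-5i)/2\rfloor}_q,\qquad b_k(q)=\sum_{i\in\mathbb Z}(-1)^iq^{i(5i+1)/2}\genfrac{[}{]}{0pt}{}{k-1}{\lfloor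 (k-1-5i)/2\rfloor}_q$$ be Garrett's polynomials. Let $x,y,z\in\mathbb C$ with $|zx|<1$. (1) For every $a\in\mathbb C$ with $azxq^k\neq 1$ for all $k\ge 0$, the following series converge (absolutely) and $$\sum_{n=0}^\infty S^*_n(x,y;q)\frac{(a;q)_n}{(q;q)_n}z^n=\frac{(azx;q)_\infty}{(zx;q)_\infty}\;{}_1\phi_2\!\left(\begin{array}{c}a\\ azx,0\end{array};q,qyz\right).$$ (2) Suppose moreover that $q\ne0$ and $yz=1$. Then, for every $a$ as in (1), the following series converge (absolutely) and $$\sum_{n=0}^\infty S^*_n(x,y;q)\frac{(a;q)_n}{(q;q)_n}z^n=\frac{(azx;q)_\infty}{(zx;q)_\infty}\sum_{k=0}^\infty q^{-\binom k2}\frac{(zx;q)_k}{(azx;q)_k(q;q)_k}(-azy)^k\left(\frac{a_{2k}(q)}{(q,q^4;q^5)_\infty}-\frac{b_{2k}(q)}{(q^2,q^3;q^5)_\infty}\right).$$ Furthermore, the identity with the two series separated, $$\sum_{n=0}^\infty S^*_n(x,y;q)\frac{(a;q)_n}{(q;q)_n}z^n=\frac{(azx;q)_\infty}{(zx;q)_\infty(q,q^4;q^5)_\infty}\sum_{k=0}^\infty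 q^{-\binom k2}\frac{(zx;q)_k\,a_{2k}(q)}{(azx;q)_k(q;q)_k}(-azy)^k-\frac{(azx;q)_\infty}{(zx;q)_\infty(q^2,q^3;q^5)_\infty}\sum_{k=0}^\infty q^{-\binom k2}\frac{(zx;q)_k\,b_{2k}(q)}{(azx;q)_k(q;q)_k}(-azy)^k,$$ holds in the ring $\mathbb C[[a]]$ of formal power series in an indeterminate $a$, where all the infinite sums and products converge coefficientwise. -/

import Mathlib

open scoped PowerSeries PowerSeries.WithPiTopology

noncomputable section

/-- The `q`-shifted factorial `(a; q)_n = ∏_{k=0}^{n-1} (1 - a q^k)`, in any commutative ring. -/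
def qPoch {R : Type*} [CommRing R] (a q : R) (n : ℕ) : R :=
  ∏ k ∈ Finset.range n, (1 - a * q ^ k)

/-- The infinite `q`-shifted factorial `(a; q)_∞ = ∏_{k ≥ 0} (1 - a q^k)`, in any commutative
topological ring. It is used for `ℂ`, and for `ℂ⟦X⟧` with the topology of coefficientwise
convergence. -/
def qPochInf {R : Type*} [CommRing R] [TopologicalSpace R] (a q : R) : R :=
  ∏' k : ℕ, (1 - a * q ^ k)

/-- The `q`-binomial coefficient `[n, j]_q = (q;q)_n / ((q;q)_j (q;q)_{n-j})`, with an integer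
lower index; it is zero unless `0 ≤ j ≤ n`. -/
def qBinom (q : ℂ) (n : ℕ) (j : ℤ) : ℂ :=
  if 0 ≤ j ∧ j ≤ n then
    qPoch q q n / (qPoch q q j.toNat * qPoch q q (n - j.toNat))
  else 0

/-- The bivariate Stieltjes-Wigert polynomial
`S*_n(x, y; q) = ∑_{k=0}^n [n, k]_q q^(k^2) x^(n-k) y^k`. -/
def stieltjesWigert (n : ℕ) (x y q : ℂ) : ℂ :=
  ∑ k ∈ Finset.range (n + 1), qBinom q n k * q ^ (k ^ 2) * x ^ (n - k) * y ^ k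

/-- The `n`-th term of the basic hypergeometric series `_rφ_s(as; bs; q, w)`, where `r` and `s`
are the lengths of the lists `as` and `bs`. -/
def basicHypergeometricTerm (as bs : List ℂ) (q w : ℂ) (n : ℕ) : ℂ :=
  (as.map fun a => qPoch a q n).prod / (qPoch q q n * (bs.map fun b => qPoch b q n).prod) *
    ((-1) ^ n * q ^ n.choose 2) ^ (1 + (bs.length : ℤ) - (as.length : ℤ)) * w ^ n

/-- The basic hypergeometric series `_rφ_s(as; bs; q, w)`. -/
def basicHypergeometric (as bs : List ℂ) (q w : ℂ) : ℂ :=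
  ∑' n : ℕ, basicHypergeometricTerm as bs q w n

/-- Garrett's polynomial
`a_k(q) = ∑_i (-1)^i q^(i(5i-3)/2) [k-1, ⌊(k+1-5i)/2⌋]_q` for `k ≥ 1`, and `a_0 = 1`.
The sum is over all integers `i`, and it has finitely many non-zero terms. The divisions by `2` are
those of the integers: exact in the exponent, rounded down in the lower index. -/
def garrettA (q : ℂ) : ℕ → ℂ
  | 0 => 1
  | k + 1 => ∑ᶠ i : ℤ, (-1) ^ i * q ^ (i * (5 * i - 3) / 2) *
      qBinom q k ((((k + 1 : ℕ) : ℤ) + 1 - 5 * i) / 2)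

/-- Garrett's polynomial
`b_k(q) = ∑_i (-1)^i q^(i(5i+1)/2) [k-1, ⌊(k-1-5i)/2⌋]_q` for `k ≥ 1`, and `b_0 = 0`. -/
def garrettB (q : ℂ) : ℕ → ℂ
  | 0 => 0
  | k + 1 => ∑ᶠ i : ℤ, (-1) ^ i * q ^ (i * (5 * i + 1) / 2) *
      qBinom q k ((((k + 1 : ℕ) : ℤ) - 1 - 5 * i) / 2)

/-- The `k`-th term
`q^(-binom(k,2)) (zx;q)_k c_{2k} (-azy)^k / ((azx;q)_k (q;q)_k)`
with the parameter `a` replaced by the variable `X` of the ring `ℂ⟦X⟧` of formal power series;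
`(Xzx;q)_k` has constant coefficient `1`, so it is invertible there. -/
def formalTerm (q x y z : ℂ) (c : ℕ → ℂ) (k : ℕ) : ℂ⟦X⟧ :=
  PowerSeries.C ((q ^ k.choose 2)⁻¹ * (qPoch (z * x) q k * c (2 * k)) / qPoch q q k) *
    (qPoch (PowerSeries.X * PowerSeries.C (z * x)) (PowerSeries.C q) k)⁻¹ *
    (-(PowerSeries.X * PowerSeries.C (z * y))) ^ k

end

/-! Dividing `stieltjesWigert` by `(q;q)_n` makes it a Cauchy convolution, so the generating
function is an absolutely convergent double series. Summing one index by the `q`-binomial theorem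
(`hasSum_qBinomialSeries`) leaves the `₁φ₂`.

If `yz = 1` and `w = zx`, the `₁φ₂` is `∑ q^(N^2) (a)_N / ((q)_N (aw)_N)`. Expanding `(a)_N / (q)_N`
by `q`-Chu-Vandermonde (`sum_antidiagonal_qPoch`) and interchanging sums leaves the inner sums `G_m
= ∑ q^(n^2+mn) / (q)_n` at `m = 2k`. By `rogersRamanujanSum_eq_garrett` these are combinations of
Garrett's polynomials: both sides solve Schur's recurrence with the same initial values. The
coefficients `G_0`, `G_1` are the Rogers-Ramanujan products, found from the limits of `a_k` and
`b_k`, which the Jacobi triple product evaluates.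

For complex `a ≠ 0` the two separated series diverge: `a_{2k}` and `b_{2k}` have nonzero limits
while `q^(-binom(k,2))` explodes. Over `ℂ⟦X⟧` the `k`-th term is divisible by `X^k`, so each
converges. The formal identity follows from the complex one on `|a| < 1` by uniqueness of Taylor
coefficients (`PowerSeries.eq_of_hasSum_eval`). -/

open Filter Topology Finset.HasAntidiagonal

/-! ### Algebra of shifted factorials -/

section Basics

variable {R : Type*} [CommRing R]

@[simp] lemma qPoch_zero (a q : R) : qPoch a q 0 = 1 := by simp [qPoch]

lemma qPoch_succ (a q : R) (n : ℕ) : qPoch a q (n + 1) = qPoch a q n * (1 - a * q ^ n) := by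
  simp [qPoch, Finset.prod_range_succ]

lemma qPoch_add (a q : R) (m n : ℕ) :
    qPoch a q (m + n) = qPoch a q m * qPoch (a * q ^ m) q n := by
  simp [qPoch, Finset.prod_range_add, pow_add, mul_assoc]

lemma qPoch_succ' (a q : R) (n : ℕ) : qPoch a q (n + 1) = (1 - a) * qPoch (a * q) q n := by
  rw [add_comm, qPoch_add]; simp [qPoch]

@[simp] lemma qPoch_zero_left (q : R) (n : ℕ) : qPoch 0 q n = 1 := by simp [qPoch]

end Basics

lemma HasSum.of_eq {ι M : Type*} [AddCommMonoid M] [TopologicalSpace M] {f g : ι → M} {s t : M}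
    (h : HasSum f s) (hfg : ∀ i, g i = f i) (hst : t = s) : HasSum g t := by
  rwa [funext hfg, hst]

/-! ### Infinite products, bounds and majorants -/

section Analytic

variable {q : ℂ}

lemma summable_neg_mul_pow (hq : ‖q‖ < 1) (a : ℂ) : Summable fun k : ℕ => ‖-(a * q ^ k)‖ := by
  simpa using (summable_geometric_of_lt_one (norm_nonneg q) hq).mul_left ‖a‖

lemma multipliable_qPoch (hq : ‖q‖ < 1) (a : ℂ) : Multipliable fun k : ℕ => 1 - a * q ^ k := by
  simpa [sub_eq_add_neg] using multipliable_one_add_of_summable (summable_neg_mul_pow hq a)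

lemma tendsto_qPoch (hq : ‖q‖ < 1) (a : ℂ) :
    Tendsto (qPoch a q) atTop (𝓝 (qPochInf a q)) :=
  (multipliable_qPoch hq a).hasProd.tendsto_prod_nat

lemma qPochInf_split (hq : ‖q‖ < 1) (a : ℂ) (k : ℕ) :
    qPochInf a q = qPoch a q k * qPochInf (a * q ^ k) q := by
  have h1 := (tendsto_qPoch hq a).comp (tendsto_add_atTop_nat k)
  refine tendsto_nhds_unique h1 ?_
  have h2 := (tendsto_qPoch hq (a * q ^ k)).const_mul (qPoch a q k)
  refine h2.congr fun n => ?_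
  simp only [Function.comp]
  rw [add_comm, qPoch_add]

lemma qPochInf_ne_zero (hq : ‖q‖ < 1) {a : ℂ} (h : ∀ k : ℕ, a * q ^ k ≠ 1) :
    qPochInf a q ≠ 0 := by
  have := tprod_one_add_ne_zero_of_summable (f := fun k : ℕ => -(a * q ^ k))
    (fun k h0 => h k (by linear_combination -h0)) (summable_neg_mul_pow hq a)
  simpa [qPochInf, sub_eq_add_neg] using this

lemma qPoch_ne_zero {a : ℂ} (h : ∀ k : ℕ, a * q ^ k ≠ 1) (n : ℕ) : qPoch a q n ≠ 0 :=
  Finset.prod_ne_zero_iff.mpr fun k _ h0 => h k (by linear_combination -h0)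

lemma mul_pow_ne_one (hq : ‖q‖ < 1) {w : ℂ} (hw : ‖w‖ < 1) (k : ℕ) : w * q ^ k ≠ 1 := by
  intro h
  have : ‖w * q ^ k‖ < 1 := by
    rw [norm_mul, norm_pow]
    calc ‖w‖ * ‖q‖ ^ k ≤ ‖w‖ * 1 := by
          gcongr; exact pow_le_one₀ (norm_nonneg _) hq.le
      _ < 1 := by simpa using hw
  simp [h] at this

lemma qPoch_self_ne_zero (hq : ‖q‖ < 1) (n : ℕ) : qPoch q q n ≠ 0 :=
  qPoch_ne_zero (mul_pow_ne_one hq hq) n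

lemma qPochInf_self_ne_zero (hq : ‖q‖ < 1) : qPochInf q q ≠ 0 :=
  qPochInf_ne_zero hq (mul_pow_ne_one hq hq)

lemma exists_norm_le_of_tendsto {f : ℕ → ℂ} {l : ℂ} (h : Tendsto f atTop (𝓝 l)) :
    ∃ C : ℝ, 0 < C ∧ ∀ n, ‖f n‖ ≤ C := by
  obtain ⟨C, hC⟩ := (Metric.isBounded_range_of_tendsto f h).exists_norm_le
  exact ⟨max C 1, by positivity, fun n => (hC _ ⟨n, rfl⟩).trans (le_max_left _ _)⟩

lemma exists_norm_qPoch_le (hq : ‖q‖ < 1) (a : ℂ) : ∃ C : ℝ, 0 < C ∧ ∀ n, ‖qPoch a q n‖ ≤ C :=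
  exists_norm_le_of_tendsto (tendsto_qPoch hq a)

lemma exists_norm_qPoch_inv_le (hq : ‖q‖ < 1) {a : ℂ} (h : ∀ k : ℕ, a * q ^ k ≠ 1) :
    ∃ C : ℝ, 0 < C ∧ ∀ n, ‖(qPoch a q n)⁻¹‖ ≤ C :=
  exists_norm_le_of_tendsto ((tendsto_qPoch hq a).inv₀ (qPochInf_ne_zero hq h))

/-- The ratio of consecutive terms is `r^n t → 0`, so the size of `t` is irrelevant. This is the
basic majorant for the interchanges of summation. -/
lemma summable_pow_choose_two_mul_pow {r : ℝ} (hr0 : 0 ≤ r) (hr : r < 1) (t : ℝ) :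
    Summable fun n : ℕ => r ^ n.choose 2 * t ^ n := by
  have hlim : Tendsto (fun n : ℕ => r ^ n * |t|) atTop (𝓝 0) := by
    simpa using (tendsto_pow_atTop_nhds_zero_of_lt_one hr0 hr).mul_const |t|
  refine summable_of_ratio_norm_eventually_le (r := 1 / 2) (by norm_num) ?_
  filter_upwards [hlim.eventually_le_const (show (0 : ℝ) < 1 / 2 by norm_num)] with n hn
  have h2 : (n + 1).choose 2 = n + n.choose 2 := by
    rw [Nat.choose_succ_succ' n 1, Nat.choose_one_right]
  have : ‖r ^ (n + 1).choose 2 * t ^ (n + 1)‖ = (r ^ n * |t|) * ‖r ^ n.choose 2 * t ^ n‖ := by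
    rw [h2, pow_add, pow_succ]
    simp only [norm_mul, norm_pow, Real.norm_eq_abs, abs_of_nonneg hr0]
    ring
  rw [this]
  gcongr

lemma hasSum_antidiagonal {u : ℕ × ℕ → ℂ} {s : ℂ} (h : HasSum u s) :
    HasSum (fun n => ∑ p ∈ antidiagonal n, u p) s := by
  have h1 := sigmaAntidiagonalEquivProd.hasSum_iff.mpr h
  refine h1.sigma fun n => ?_
  have := hasSum_fintype fun p : antidiagonal n => u p
  rwa [Finset.sum_coe_sort (antidiagonal n) u] at this

end Analytic

/-! ### The `q`-binomial theorem, the `₁φ₂` and `q`-Chu-Vandermonde -/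

section FirstPart

variable {q : ℂ}

lemma exists_norm_qPoch_div_le (hq : ‖q‖ < 1) (a : ℂ) :
    ∃ C : ℝ, 0 < C ∧ ∀ n, ‖qPoch a q n / qPoch q q n‖ ≤ C :=
  exists_norm_le_of_tendsto ((tendsto_qPoch hq a).div (tendsto_qPoch hq q)
    (qPochInf_self_ne_zero hq))

lemma summable_qBinomialSeries (hq : ‖q‖ < 1) (a : ℂ) {w : ℂ} (hw : ‖w‖ < 1) :
    Summable fun m : ℕ => qPoch a q m / qPoch q q m * w ^ m := by
  obtain ⟨C, -, hC⟩ := exists_norm_qPoch_div_le hq a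
  refine .of_norm_bounded ((summable_geometric_of_lt_one (norm_nonneg w) hw).mul_left C) fun m => ?_
  rw [norm_mul, norm_pow]
  gcongr
  exact hC m

/-- The coefficients satisfy `(1 - q^(m+1)) c_{m+1} = (1 - a q^m) c_m`, so `F(w) - F(wq) = w F(w) -
a w F(wq)`. -/
lemma qBinomialSeries_functional (hq : ‖q‖ < 1) (a : ℂ) {w : ℂ} (hw : ‖w‖ < 1) :
    (1 - w) * ∑' m : ℕ, qPoch a q m / qPoch q q m * w ^ m =
      (1 - a * w) * ∑' m : ℕ, qPoch a q m / qPoch q q m * (w * q) ^ m := by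
  have hwq : ‖w * q‖ < 1 := by
    rw [norm_mul]; exact mul_lt_one_of_nonneg_of_lt_one_left (norm_nonneg _) hw hq.le
  have h1 := summable_qBinomialSeries hq a hw
  have h2 := summable_qBinomialSeries hq a hwq
  have key : ∀ m : ℕ, qPoch a q (m + 1) / qPoch q q (m + 1) * w ^ (m + 1) -
      qPoch a q (m + 1) / qPoch q q (m + 1) * (w * q) ^ (m + 1) =
      w * (qPoch a q m / qPoch q q m * w ^ m) -
        a * w * (qPoch a q m / qPoch q q m * (w * q) ^ m) := by
    intro m
    have h0' : 1 - q * q ^ m ≠ 0 := sub_ne_zero.mpr (mul_pow_ne_one hq hq m).symm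
    have hd : (1 - a * q ^ m) / (1 - q * q ^ m) * (1 - q * q ^ m) = 1 - a * q ^ m :=
      div_mul_cancel₀ _ h0'
    rw [qPoch_succ, qPoch_succ, mul_div_mul_comm]
    linear_combination (qPoch a q m / qPoch q q m * w ^ (m + 1)) * hd
  have e := (h1.sub h2).tsum_eq_zero_add
  simp only [key] at e
  rw [h1.tsum_sub h2, (h1.mul_left w).tsum_sub (h2.mul_left (a * w)), tsum_mul_left,
    tsum_mul_left] at e
  simp only [pow_zero, sub_self, zero_add] at e
  linear_combination e

/-- The `q`-binomial theorem. -/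
lemma hasSum_qBinomialSeries (hq : ‖q‖ < 1) (a : ℂ) {w : ℂ} (hw : ‖w‖ < 1) :
    HasSum (fun m : ℕ => qPoch a q m / qPoch q q m * w ^ m)
      (qPochInf (a * w) q / qPochInf w q) := by
  have hqn : ∀ n : ℕ, ‖w * q ^ n‖ ≤ ‖w‖ := fun n => by
    rw [norm_mul, norm_pow]
    exact mul_le_of_le_one_right (norm_nonneg _) (pow_le_one₀ (norm_nonneg _) hq.le)
  -- Iterating the functional equation drives the argument to `0`, where the series equals `1`.
  have iter : ∀ n : ℕ, qPoch w q n * ∑' m : ℕ, qPoch a q m / qPoch q q m * w ^ m =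
      qPoch (a * w) q n * ∑' m : ℕ, qPoch a q m / qPoch q q m * (w * q ^ n) ^ m := by
    intro n
    induction n with
    | zero => simp
    | succ n ih =>
      have := qBinomialSeries_functional hq a ((hqn n).trans_lt hw)
      rw [qPoch_succ, qPoch_succ, pow_succ, ← mul_assoc w]
      linear_combination (1 - w * q ^ n) * ih + qPoch (a * w) q n * this
  have lim : Tendsto (fun n : ℕ => ∑' m : ℕ, qPoch a q m / qPoch q q m * (w * q ^ n) ^ m) atTop
      (𝓝 (∑' m : ℕ, qPoch a q m / qPoch q q m * 0 ^ m)) := by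
    refine tendsto_tsum_of_dominated_convergence (summable_qBinomialSeries hq a hw).norm
      (fun m => ?_) (.of_forall fun n m => ?_)
    · have : Tendsto (fun n : ℕ => w * q ^ n) atTop (𝓝 0) := by
        simpa using (tendsto_pow_atTop_nhds_zero_of_norm_lt_one hq).const_mul w
      exact (this.pow m).const_mul _
    · rw [norm_mul, norm_mul, norm_pow, norm_pow]
      gcongr
      exact hqn n
  have h0 : ∑' m : ℕ, qPoch a q m / qPoch q q m * (0 : ℂ) ^ m = 1 := by
    rw [tsum_eq_single 0 fun m hm => by simp [hm]]
    simp
  rw [h0] at lim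
  have := tendsto_nhds_unique (((tendsto_qPoch hq w).mul_const _).congr iter)
    ((tendsto_qPoch hq (a * w)).mul lim)
  have hne := qPochInf_ne_zero hq (mul_pow_ne_one hq hw)
  rw [← (eq_div_iff hne).mpr ((mul_comm _ _).trans (this.trans (mul_one _)))]
  exact (summable_qBinomialSeries hq a hw).hasSum

lemma stieltjesWigert_div (hq : ‖q‖ < 1) (n : ℕ) (x y : ℂ) :
    stieltjesWigert n x y q / qPoch q q n =
      ∑ p ∈ antidiagonal n, q ^ (p.1 ^ 2) * x ^ p.2 * y ^ p.1 / (qPoch q q p.1 * qPoch q q p.2) := by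
  rw [Finset.Nat.sum_antidiagonal_eq_sum_range_succ_mk, stieltjesWigert, Finset.sum_div]
  refine Finset.sum_congr rfl fun k hk => ?_
  have hk' : k ≤ n := by simpa [Nat.lt_succ_iff] using hk
  have h0 := qPoch_self_ne_zero hq
  have := h0 n
  have := h0 k
  have := h0 (n - k)
  simp only [qBinom, Nat.cast_nonneg, Nat.cast_le, hk', and_self, if_true, Int.toNat_natCast]
  field_simp

lemma summable_pow_sq_mul_pow (hq : ‖q‖ < 1) (t : ℝ) :
    Summable fun k : ℕ => ‖q‖ ^ (k ^ 2) * t ^ k := by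
  have h := summable_pow_choose_two_mul_pow (r := ‖q‖ ^ 2) (by positivity)
    (pow_lt_one₀ (norm_nonneg _) hq two_ne_zero) (‖q‖ * t)
  refine h.congr fun k => ?_
  rw [mul_pow, ← mul_assoc, ← pow_mul, ← pow_add, Nat.choose_two_right,
    Nat.mul_div_cancel' (Nat.even_mul_pred_self k).two_dvd]
  congr 2
  cases k with
  | zero => rfl
  | succ k => simp; ring

/-- The shifted factorials and their inverses are bounded, which leaves `q^(k^2) v^k` times a
geometric series in `w`. -/
lemma summable_stieltjesWigert_double (hq : ‖q‖ < 1) (a : ℂ) {v w : ℂ} (hw : ‖w‖ < 1) :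
    Summable fun p : ℕ × ℕ => q ^ (p.1 ^ 2) * v ^ p.1 * w ^ p.2 * qPoch a q (p.1 + p.2) /
      (qPoch q q p.1 * qPoch q q p.2) := by
  obtain ⟨A, hA0, hA⟩ := exists_norm_qPoch_le hq a
  obtain ⟨B, hB0, hB⟩ := exists_norm_qPoch_inv_le hq (mul_pow_ne_one hq hq)
  have hs := ((summable_pow_sq_mul_pow hq ‖v‖).mul_of_nonneg
    (summable_geometric_of_lt_one (norm_nonneg w) hw) (fun _ => by positivity)
    (fun _ => by positivity)).mul_left (A * (B * B))
  refine .of_norm_bounded hs fun p => ?_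
  rw [div_eq_mul_inv, mul_inv]
  simp only [norm_mul, norm_pow]
  calc _ ≤ ‖q‖ ^ (p.1 ^ 2) * ‖v‖ ^ p.1 * ‖w‖ ^ p.2 * A * (B * B) := by
        gcongr
        exacts [hA _, hB _, hB _]
    _ = _ := by ring

/-- The generating function of the Stieltjes-Wigert polynomials as a series in the parameters. -/
lemma hasSum_stieltjesWigert (hq : ‖q‖ < 1) {x y z a : ℂ} (hzx : ‖z * x‖ < 1)
    (ha : ∀ k : ℕ, a * z * x * q ^ k ≠ 1) :
    HasSum (fun n : ℕ => stieltjesWigert n x y q * (qPoch a q n / qPoch q q n) * z ^ n)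
      (qPochInf (a * z * x) q / qPochInf (z * x) q *
        ∑' k : ℕ, q ^ (k ^ 2) * (y * z) ^ k * (qPoch a q k / (qPoch q q k * qPoch (a * z * x) q k))) ∧
    Summable fun k : ℕ =>
      q ^ (k ^ 2) * (y * z) ^ k * (qPoch a q k / (qPoch q q k * qPoch (a * z * x) q k)) := by
  have hsum := summable_stieltjesWigert_double hq a (v := y * z) hzx
  -- Since `(a)_{k+m} = (a)_k (a q^k)_m`, each row is a `q`-binomial series with parameter `a q^k`.
  have hrow : ∀ k : ℕ, HasSum (fun m : ℕ => q ^ (k ^ 2) * (y * z) ^ k * (z * x) ^ m *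
      qPoch a q (k + m) / (qPoch q q k * qPoch q q m))
      (qPochInf (a * z * x) q / qPochInf (z * x) q * (q ^ (k ^ 2) * (y * z) ^ k *
        (qPoch a q k / (qPoch q q k * qPoch (a * z * x) q k)))) := by
    intro k
    have h := (hasSum_qBinomialSeries hq (a * q ^ k) hzx).mul_left
      (q ^ (k ^ 2) * (y * z) ^ k * (qPoch a q k / qPoch q q k))
    have e : qPochInf (a * z * x) q = qPoch (a * z * x) q k * qPochInf (a * q ^ k * (z * x)) q := by
      rw [qPochInf_split hq _ k]; congr 2; ring
    have h0 := qPoch_ne_zero ha k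
    refine h.of_eq (fun m => ?_) ?_
    · rw [qPoch_add]
      ring
    · rw [e]
      field_simp
  have hdiag := hasSum_antidiagonal hsum.hasSum
  have hcol := hsum.hasSum.prod_fiberwise hrow
  -- A nonzero prefactor can be cancelled, so summability of the row sums passes to the `₁φ₂`
  -- itself.
  have hne : qPochInf (a * z * x) q / qPochInf (z * x) q ≠ 0 :=
    div_ne_zero (qPochInf_ne_zero hq ha) (qPochInf_ne_zero hq (mul_pow_ne_one hq hzx))
  refine ⟨?_, (summable_mul_left_iff hne).mp hcol.summable⟩
  refine hdiag.of_eq (fun n => ?_) (by rw [← tsum_mul_left, hcol.tsum_eq])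
  have e : stieltjesWigert n x y q * (qPoch a q n / qPoch q q n) * z ^ n =
      stieltjesWigert n x y q / qPoch q q n * (qPoch a q n * z ^ n) := by ring
  rw [e, stieltjesWigert_div hq, Finset.sum_mul]
  refine Finset.sum_congr rfl fun p hp => ?_
  rw [← Finset.HasAntidiagonal.mem_antidiagonal.mp hp]
  ring

/-- The Gaussian exponent is `2 binom(n,2) + n = n^2`, and the lower parameter `0` contributes the
factor `1`. -/
lemma basicHypergeometricTerm_eq (a b y z : ℂ) (n : ℕ) :
    basicHypergeometricTerm [a] [b, 0] q (q * y * z) n =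
      q ^ (n ^ 2) * (y * z) ^ n * (qPoch a q n / (qPoch q q n * qPoch b q n)) := by
  have h2 : (1 : ℤ) + (([b, 0] : List ℂ).length : ℤ) - (([a] : List ℂ).length : ℤ) =
      ((2 : ℕ) : ℤ) := by simp
  have e : ((-1) ^ n * q ^ n.choose 2) ^ 2 * (q * y * z) ^ n = q ^ (n ^ 2) * (y * z) ^ n := by
    rw [mul_pow, ← pow_mul, mul_comm n 2, pow_mul, neg_one_sq, one_pow, one_mul, mul_assoc q,
      mul_pow q, ← mul_assoc, ← pow_mul, ← pow_add, Nat.choose_two_right,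
      Nat.div_mul_cancel (Nat.even_mul_pred_self n).two_dvd]
    congr 2
    cases n with
    | zero => rfl
    | succ k => simp; ring
  rw [basicHypergeometricTerm, h2, zpow_natCast, mul_assoc, e]
  simp
  ring

/-- The `q`-Chu-Vandermonde sum, in a symmetric form. -/
lemma sum_antidiagonal_qPoch (hq : ‖q‖ < 1) (w : ℂ) (n : ℕ) (a : ℂ) :
    ∑ p ∈ antidiagonal n, (-a) ^ p.1 * q ^ p.1.choose 2 * qPoch w q p.1 *
      qPoch (a * w * q ^ p.1) q p.2 / (qPoch q q p.1 * qPoch q q p.2) =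
      qPoch a q n / qPoch q q n := by
  induction n generalizing a with
  | zero => simp
  | succ n ih =>
    have hne : ∀ k : ℕ, 1 - q * q ^ k ≠ 0 := fun k => sub_ne_zero.mpr (mul_pow_ne_one hq hq k).symm
    set F : ℕ × ℕ → ℂ := fun p => (-a) ^ p.1 * q ^ p.1.choose 2 * qPoch w q p.1 *
      qPoch (a * w * q ^ p.1) q p.2 / (qPoch q q p.1 * qPoch q q p.2) with hF
    -- For `i + j = n + 1`, `1 - q^(n+1) = q^j`-free split `q^i (1 - q^j) + (1 - q^i)`: each part
    -- cancels the last factor of `(q)_j` or `(q)_i`.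
    have hsplit : (1 - q * q ^ n) * ∑ p ∈ antidiagonal (n + 1), F p =
        ∑ p ∈ antidiagonal (n + 1), q ^ p.1 * (1 - q ^ p.2) * F p +
          ∑ p ∈ antidiagonal (n + 1), (1 - q ^ p.1) * F p := by
      rw [Finset.mul_sum, ← Finset.sum_add_distrib]
      refine Finset.sum_congr rfl fun p hp => ?_
      rw [← pow_succ', ← Finset.HasAntidiagonal.mem_antidiagonal.mp hp, pow_add]
      ring
    rw [Finset.Nat.sum_antidiagonal_succ' (f := fun p => q ^ p.1 * (1 - q ^ p.2) * F p),
      Finset.Nat.sum_antidiagonal_succ (f := fun p => (1 - q ^ p.1) * F p)] at hsplit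
    simp only [pow_zero, sub_self, zero_mul, mul_zero, zero_add] at hsplit
    rw [← Finset.sum_add_distrib] at hsplit
    -- The two parts combine through `(1 - a w q^i) - a (1 - w q^i) = 1 - a`, which leaves the sum
    -- of order `n` at `aq`; hence the induction over all `a`.
    have hterm : ∀ p : ℕ × ℕ, q ^ p.1 * (1 - q ^ (p.2 + 1)) * F (p.1, p.2 + 1) +
        (1 - q ^ (p.1 + 1)) * F (p.1 + 1, p.2) = (1 - a) * ((-(a * q)) ^ p.1 *
          q ^ p.1.choose 2 * qPoch w q p.1 * qPoch (a * q * w * q ^ p.1) q p.2 /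
            (qPoch q q p.1 * qPoch q q p.2)) := by
      rintro ⟨i, j⟩
      have hc : (i + 1).choose 2 = i + i.choose 2 := by
        rw [Nat.choose_succ_succ' i 1, Nat.choose_one_right]
      have e1 : a * w * q ^ i * q = a * q * w * q ^ i := by ring
      have e2 : a * w * q ^ (i + 1) = a * q * w * q ^ i := by ring
      have hd : ∀ k : ℕ, (1 - q ^ (k + 1)) / (1 - q * q ^ k) = 1 := fun k => by
        rw [pow_succ']; exact div_self (hne k)
      have s1 : F (i, j + 1) = (-a) ^ i * q ^ i.choose 2 * qPoch w q i *
          (1 - a * w * q ^ i) * qPoch (a * q * w * q ^ i) q j /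
            (qPoch q q i * qPoch q q j) / (1 - q * q ^ j) := by
        simp only [hF]
        rw [qPoch_succ', e1, qPoch_succ q]
        simp only [div_eq_mul_inv, mul_inv]
        ring
      have s2 : F (i + 1, j) = (-a) ^ i * (-a) * q ^ i * q ^ i.choose 2 * qPoch w q i *
          (1 - w * q ^ i) * qPoch (a * q * w * q ^ i) q j /
            (qPoch q q i * qPoch q q j) / (1 - q * q ^ i) := by
        simp only [hF]
        rw [hc, e2, qPoch_succ w, qPoch_succ q]
        simp only [div_eq_mul_inv, mul_inv]
        ring
      rw [s1, s2]
      have hi := hd i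
      have hj := hd j
      set D := qPoch q q i * qPoch q q j
      set P := qPoch (a * q * w * q ^ i) q j
      simp only [neg_mul_eq_neg_mul, mul_pow]
      linear_combination (q ^ i * ((-a) ^ i * q ^ i.choose 2 * qPoch w q i *
        (1 - a * w * q ^ i) * P / D)) * hj + ((-a) ^ i * (-a) * q ^ i * q ^ i.choose 2 *
          qPoch w q i * (1 - w * q ^ i) * P / D) * hi
    simp only [hterm] at hsplit
    rw [← Finset.mul_sum, ih (a * q), ← mul_div_assoc, ← qPoch_succ'] at hsplit
    rw [qPoch_succ q, mul_comm (qPoch q q n), ← div_div, div_right_comm, ← hsplit,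
      mul_div_cancel_left₀ _ (hne n)]

/-- The double series behind the expansion in Garrett's polynomials. -/
lemma hasSum_qChuVandermonde_double (hq : ‖q‖ < 1) {w a : ℂ} (ha : ∀ k : ℕ, a * w * q ^ k ≠ 1) :
    Summable (fun p : ℕ × ℕ => q ^ ((p.1 + p.2) ^ 2) * ((-a) ^ p.1 * q ^ p.1.choose 2 *
      qPoch w q p.1 / (qPoch (a * w) q p.1 * (qPoch q q p.1 * qPoch q q p.2)))) ∧
    ∑' N : ℕ, q ^ (N ^ 2) * (qPoch a q N / (qPoch q q N * qPoch (a * w) q N)) =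
      ∑' p : ℕ × ℕ, q ^ ((p.1 + p.2) ^ 2) * ((-a) ^ p.1 * q ^ p.1.choose 2 *
      qPoch w q p.1 / (qPoch (a * w) q p.1 * (qPoch q q p.1 * qPoch q q p.2))) := by
  have hS : Summable (fun p : ℕ × ℕ => q ^ ((p.1 + p.2) ^ 2) * ((-a) ^ p.1 * q ^ p.1.choose 2 *
      qPoch w q p.1 / (qPoch (a * w) q p.1 * (qPoch q q p.1 * qPoch q q p.2)))) := by
    obtain ⟨A, hA0, hA⟩ := exists_norm_qPoch_le hq w
    obtain ⟨B, hB0, hB⟩ := exists_norm_qPoch_inv_le hq (mul_pow_ne_one hq hq)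
    obtain ⟨D, hD0, hD⟩ := exists_norm_qPoch_inv_le hq ha
    have hs := ((summable_pow_choose_two_mul_pow (norm_nonneg q) hq ‖a‖).mul_of_nonneg
      (summable_pow_sq_mul_pow hq 1) (fun _ => by positivity)
      (fun _ => by positivity)).mul_left (A * D * (B * B))
    refine .of_norm_bounded hs fun p => ?_
    rw [div_eq_mul_inv, mul_inv, mul_inv]
    simp only [norm_mul, norm_pow, norm_neg]
    -- Lowering the exponent `(i+j)^2` to `j^2` separates the variables; `q^(binom(i,2))` still
    -- controls `a^i`.
    calc _ ≤ ‖q‖ ^ (p.2 ^ 2) * (‖a‖ ^ p.1 * ‖q‖ ^ p.1.choose 2 * A * (D * (B * B))) := by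
          gcongr ?_ * (_ * _ * ?_ * (?_ * (?_ * ?_)))
          · exact pow_le_pow_of_le_one (norm_nonneg _) hq.le (by gcongr; omega)
          exacts [hA _, hD _, hB _, hB _]
      _ = _ := by ring
  refine ⟨hS, ?_⟩
  rw [← (hasSum_antidiagonal hS.hasSum).tsum_eq]
  refine tsum_congr fun N => ?_
  have hN := sum_antidiagonal_qPoch hq w N a
  have h0 := qPoch_ne_zero ha
  rw [← div_div, ← hN, Finset.sum_div, Finset.mul_sum]
  refine Finset.sum_congr rfl fun p hp => ?_
  have := h0 p.1
  have h1 := h0 (p.1 + p.2)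
  rw [← Finset.HasAntidiagonal.mem_antidiagonal.mp hp]
  -- `(aw)_{i+j} = (aw)_i (a w q^i)_j`, whose second factor cancels the one in the Chu-Vandermonde
  -- summand.
  rw [qPoch_add] at h1 ⊢
  have := right_ne_zero_of_mul h1
  field_simp

end FirstPart

/-! ### `q`-binomial coefficients with integer lower index -/

section QBinomial

variable {q : ℂ}

lemma qBinom_eq_zero {n : ℕ} {j : ℤ} (h : ¬(0 ≤ j ∧ j ≤ n)) : qBinom q n j = 0 := if_neg h

lemma qBinom_add_natCast (i m : ℕ) :
    qBinom q (i + m) i = qPoch q q (i + m) / (qPoch q q i * qPoch q q m) := by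
  simp [qBinom]

lemma qBinom_symm (n : ℕ) (j : ℤ) : qBinom q n (n - j) = qBinom q n j := by
  by_cases h : 0 ≤ j ∧ j ≤ n
  · obtain ⟨i, rfl⟩ := Int.eq_ofNat_of_zero_le h.1
    obtain ⟨m, rfl⟩ := Nat.exists_eq_add_of_le (Int.ofNat_le.mp h.2)
    rw [qBinom_add_natCast, Nat.cast_add, add_sub_cancel_left, add_comm i m, qBinom_add_natCast,
      mul_comm]
  · rw [qBinom_eq_zero h, qBinom_eq_zero (by omega)]

lemma qBinom_zero_right (hq : ‖q‖ < 1) (n : ℕ) : qBinom q n 0 = 1 := by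
  have := qPoch_self_ne_zero hq n
  simp [qBinom, this]

lemma qBinom_self (hq : ‖q‖ < 1) (n : ℕ) : qBinom q n n = 1 := by
  rw [← qBinom_symm, sub_self, qBinom_zero_right hq]

/-- In the interior this is `1 - q^(i+m+2) = (1 - q^(i+1)) + q^(i+1) (1 - q^(m+1))`. Allowing every
integer `j` lets the later sums run over `ℤ` without boundary terms. -/
lemma qBinom_succ (hq : ‖q‖ < 1) (n : ℕ) (j : ℤ) :
    qBinom q (n + 1) j = qBinom q n (j - 1) + q ^ j * qBinom q n j := by
  by_cases h : 0 ≤ j ∧ j ≤ (n + 1 : ℕ)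
  · obtain ⟨i, rfl⟩ := Int.eq_ofNat_of_zero_le h.1
    obtain ⟨m, hm⟩ := Nat.exists_eq_add_of_le (Int.ofNat_le.mp h.2)
    rcases i with _ | i
    · simp only [Nat.cast_zero, zero_sub, zpow_zero, one_mul]
      rw [qBinom_zero_right hq, qBinom_zero_right hq, qBinom_eq_zero (by omega), zero_add]
    rcases m with _ | m
    · obtain rfl : n = i := by omega
      rw [qBinom_self hq, qBinom_eq_zero (n := n) (j := ((n + 1 : ℕ) : ℤ)) (by omega),
        show ((n + 1 : ℕ) : ℤ) - 1 = n by push_cast; ring, qBinom_self hq]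
      simp
    · obtain rfl : n = i + 1 + m := by omega
      have e1 : qBinom q (i + 1 + m + 1) ((i + 1 : ℕ) : ℤ) = _ := qBinom_add_natCast (i + 1) (m + 1)
      have e2 : qBinom q (i + 1 + m) (((i + 1 : ℕ) : ℤ) - 1) = qPoch q q (i + 1 + m) /
          (qPoch q q i * qPoch q q (m + 1)) := by
        have := qBinom_add_natCast (q := q) i (m + 1)
        rw [show i + (m + 1) = i + 1 + m by ring] at this
        rw [← this]
        congr 1
        push_cast; ring
      rw [e1, e2, qBinom_add_natCast, zpow_natCast, ← add_assoc (i + 1) m 1, qPoch_succ q q (i + 1 + m),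
        qPoch_succ q q i, qPoch_succ q q m]
      have h0 := qPoch_self_ne_zero hq
      have hi := h0 i
      have hm := h0 m
      have hi' : 1 - q * q ^ i ≠ 0 := sub_ne_zero.mpr (mul_pow_ne_one hq hq i).symm
      have hm' : 1 - q * q ^ m ≠ 0 := sub_ne_zero.mpr (mul_pow_ne_one hq hq m).symm
      rw [show 1 - q * q ^ (i + 1 + m) = (1 - q * q ^ i) + q ^ (i + 1) * (1 - q * q ^ m) by ring]
      generalize 1 - q * q ^ i = α at *
      generalize 1 - q * q ^ m = β at *
      generalize q ^ (i + 1) = Q at *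
      field_simp
  · rw [qBinom_eq_zero h, qBinom_eq_zero (by omega)]
    by_cases h' : j < 0 ∨ n + 1 < j
    · rw [qBinom_eq_zero (by omega)]; simp
    · omega

lemma qBinom_succ' (hq : ‖q‖ < 1) (n : ℕ) (j : ℤ) :
    qBinom q (n + 1) j = qBinom q n j + q ^ (n + 1 - j) * qBinom q n (j - 1) := by
  rw [← qBinom_symm, qBinom_succ hq, ← qBinom_symm n j, ← qBinom_symm n (j - 1)]
  push_cast
  congr 2
  · ring
  · congr 1; ring

end QBinomial

/-! ### Schur's recurrence for Garrett's polynomials -/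

section Schur

variable {q : ℂ}

/-- The general term of the sums over `ℤ` that define Garrett's polynomials. -/
noncomputable def schurTerm (q : ℂ) (s : ℤ) (k : ℕ) (i : ℤ) : ℂ :=
  (-1) ^ i * q ^ (i * (5 * i + 1) / 2 - 2 * i * s) * qBinom q k ((k - 5 * i) / 2 + s)

lemma hasFiniteSupport_mul_qBinom {k : ℕ} (c : ℤ → ℂ) {f : ℤ → ℤ} (M : ℤ)
    (h : ∀ i, 0 ≤ f i → f i ≤ k → -M ≤ i ∧ i ≤ M) :
    Function.HasFiniteSupport fun i => c i * qBinom q k (f i) := by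
  refine (Set.finite_Icc (-M) M).subset fun i hi => ?_
  have : 0 ≤ f i ∧ f i ≤ k := by
    by_contra h0
    exact hi (by simp [qBinom_eq_zero h0])
  exact h i this.1 this.2

lemma hasFiniteSupport_schurTerm (q : ℂ) (s : ℤ) (k : ℕ) :
    Function.HasFiniteSupport (schurTerm q s k) :=
  hasFiniteSupport_mul_qBinom _ (k + 2 * |s| + 2) fun i h1 h2 => by
    have := le_abs_self s
    have := neg_abs_le s
    omega

lemma summable_schurTerm (q : ℂ) (s : ℤ) (k : ℕ) : Summable (schurTerm q s k) :=
  summable_of_hasFiniteSupport (hasFiniteSupport_schurTerm q s k)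

/-- Fixing the parity of `i` removes the floor; here `m = ⌊k/2⌋`, and `⌊(k+1)/2⌋` for odd `i`. -/
lemma schurTerm_even (s : ℤ) (k : ℕ) (j m : ℤ) (hm : (k : ℤ) = 2 * m ∨ (k : ℤ) = 2 * m + 1) :
    schurTerm q s k (2 * j) =
      q ^ (10 * j ^ 2 + j - 4 * j * s) * qBinom q k (m - 5 * j + s) := by
  rw [schurTerm, (even_two_mul j).neg_one_zpow, one_mul]
  congr 2
  · rw [mul_assoc 2 j, Int.mul_ediv_cancel_left _ two_ne_zero]; ring
  · omega

lemma schurTerm_odd (s : ℤ) (k : ℕ) (j m : ℤ)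
    (hm : (k : ℤ) + 1 = 2 * m ∨ (k : ℤ) + 1 = 2 * m + 1) :
    schurTerm q s k (2 * j + 1) =
      -(q ^ (10 * j ^ 2 + 11 * j + 3 - 2 * (2 * j + 1) * s) * qBinom q k (m - 5 * j - 3 + s)) := by
  rw [schurTerm, (odd_two_mul_add_one j).neg_one_zpow, neg_one_mul, neg_mul]
  congr 3
  · rw [show (2 * j + 1) * (5 * (2 * j + 1) + 1) = 2 * ((2 * j + 1) * (5 * j + 3)) by ring,
      Int.mul_ediv_cancel_left _ two_ne_zero]; ring
  · omega

/-- The recurrence fails term by term. Two different Pascal rules leave a remainder, which for even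
`i` is opposite to that of an odd neighbour, so the defect telescopes. -/
lemma schurTerm_recurrence (hq : ‖q‖ < 1) (hq0 : q ≠ 0) (s : ℤ) (k : ℕ) :
    ∃ U : ℤ → ℂ, ∃ d : ℤ, Summable U ∧ ∀ i, schurTerm q s (k + 2) i =
      schurTerm q s (k + 1) i + q ^ (k + 1) * schurTerm q s k i + (U i - U (i + d)) := by
  obtain ⟨n, rfl | rfl⟩ := Nat.even_or_odd' k
  -- `U` is the Pascal remainder at even `i`. For even `k`, the index `2j` is paired with `2j - 1`,
  -- hence `d = 1`.
  · set U : ℤ → ℂ := fun i => (if Even i then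
      q ^ (10 * (i / 2) ^ 2 - 4 * (i / 2) - 4 * (i / 2) * s + n + 1 + s) else 0) *
        qBinom q (2 * n) (n + 1 - 5 * (i / 2) + s) with hU
    have hU0 : ∀ j, U (2 * j) = q ^ (10 * j ^ 2 - 4 * j - 4 * j * s + n + 1 + s) *
        qBinom q (2 * n) (n + 1 - 5 * j + s) := fun j => by
      simp [hU]
    have hU1 : ∀ j, U (2 * j + 1) = 0 := fun j => by
      simp [hU]
    refine ⟨U, 1, summable_of_hasFiniteSupport
      (hasFiniteSupport_mul_qBinom _ (2 * n + 2 * |s| + 20) fun i h1 h2 => ?_), fun i => ?_⟩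
    · have := le_abs_self s
      have := neg_abs_le s
      omega
    obtain ⟨j, rfl | rfl⟩ := Int.even_or_odd' i
    · rw [hU0, hU1, schurTerm_even s _ j (n + 1) (by omega), schurTerm_even s _ j n (by omega),
        schurTerm_even s _ j n (by omega), qBinom_succ hq (2 * n + 1), qBinom_succ' hq (2 * n) (n + 1 - 5 * j + s)]
      rw [show (n : ℤ) + 1 - 5 * j + s - 1 = n - 5 * j + s by ring]
      -- In all four cases `h1` produces the coefficient `q^(k+1)` of the recurrence, and `h2`
      -- identifies the remainder with `U`.
      have h1 : q ^ ((n : ℤ) + 1 - 5 * j + s) * q ^ (((2 * n : ℕ) : ℤ) + 1 - (n + 1 - 5 * j + s)) =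
          q ^ (2 * n + 1) := by
        rw [← zpow_add₀ hq0, ← zpow_natCast]; congr 1; push_cast; ring
      have h2 : q ^ (10 * j ^ 2 + j - 4 * j * s) * q ^ ((n : ℤ) + 1 - 5 * j + s) =
          q ^ (10 * j ^ 2 - 4 * j - 4 * j * s + n + 1 + s) := by
        rw [← zpow_add₀ hq0]; congr 1; ring
      linear_combination (q ^ (10 * j ^ 2 + j - 4 * j * s) * qBinom q (2 * n) (n - 5 * j + s)) * h1 +
        qBinom q (2 * n) (n + 1 - 5 * j + s) * h2
    · rw [show 2 * j + 1 + 1 = 2 * (j + 1) by ring, hU0, hU1,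
        schurTerm_odd s _ j (n + 1) (by push_cast; omega), schurTerm_odd s _ j (n + 1) (by push_cast; omega),
        schurTerm_odd s _ j n (by push_cast; omega), qBinom_succ' hq (2 * n + 1),
        qBinom_succ hq (2 * n) ((n : ℤ) + 1 - 5 * j - 3 + s - 1)]
      rw [show (n : ℤ) + 1 - 5 * j - 3 + s - 1 - 1 = n + 1 - 5 * (j + 1) + s by ring,
        show (n : ℤ) + 1 - 5 * j - 3 + s - 1 = n - 5 * j - 3 + s by ring]
      have h1 : q ^ (((2 * n + 1 : ℕ) : ℤ) + 1 - (n + 1 - 5 * j - 3 + s)) *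
          q ^ ((n : ℤ) - 5 * j - 3 + s) = q ^ (2 * n + 1) := by
        rw [← zpow_add₀ hq0, ← zpow_natCast]; congr 1; push_cast; ring
      have h2 : q ^ (10 * j ^ 2 + 11 * j + 3 - 2 * (2 * j + 1) * s) *
          q ^ (((2 * n + 1 : ℕ) : ℤ) + 1 - (n + 1 - 5 * j - 3 + s)) =
          q ^ (10 * (j + 1) ^ 2 - 4 * (j + 1) - 4 * (j + 1) * s + n + 1 + s) := by
        rw [← zpow_add₀ hq0]; congr 1; push_cast; ring
      linear_combination -(q ^ (10 * j ^ 2 + 11 * j + 3 - 2 * (2 * j + 1) * s) *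
        qBinom q (2 * n) (n - 5 * j - 3 + s)) * h1 -
          qBinom q (2 * n) (n + 1 - 5 * (j + 1) + s) * h2
  -- For odd `k`, the index `2j` is paired with `2j + 1` instead, hence `d = -1`.
  · set U : ℤ → ℂ := fun i => (if Even i then
      q ^ (10 * (i / 2) ^ 2 + 6 * (i / 2) - 4 * (i / 2) * s + n + 2 - s) else 0) *
        qBinom q (2 * n + 1) (n - 1 - 5 * (i / 2) + s) with hU
    have hU0 : ∀ j, U (2 * j) = q ^ (10 * j ^ 2 + 6 * j - 4 * j * s + n + 2 - s) *
        qBinom q (2 * n + 1) (n - 1 - 5 * j + s) := fun j => by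
      simp [hU]
    have hU1 : ∀ j, U (2 * j + 1) = 0 := fun j => by
      simp [hU]
    refine ⟨U, -1, summable_of_hasFiniteSupport
      (hasFiniteSupport_mul_qBinom _ (2 * n + 2 * |s| + 20) fun i h1 h2 => ?_), fun i => ?_⟩
    · have := le_abs_self s
      have := neg_abs_le s
      omega
    obtain ⟨j, rfl | rfl⟩ := Int.even_or_odd' i
    · rw [show 2 * j + -1 = 2 * (j - 1) + 1 by ring, hU0, hU1,
        schurTerm_even s _ j (n + 1) (by push_cast; omega),
        schurTerm_even s _ j (n + 1) (by push_cast; omega),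
        schurTerm_even s _ j n (by push_cast; omega), qBinom_succ' hq (2 * n + 1 + 1),
        qBinom_succ hq (2 * n + 1) ((n : ℤ) + 1 - 5 * j + s - 1)]
      rw [show (n : ℤ) + 1 - 5 * j + s - 1 - 1 = n - 1 - 5 * j + s by ring,
        show (n : ℤ) + 1 - 5 * j + s - 1 = n - 5 * j + s by ring]
      have h1 : q ^ (((2 * n + 1 + 1 : ℕ) : ℤ) + 1 - (n + 1 - 5 * j + s)) *
          q ^ ((n : ℤ) - 5 * j + s) = q ^ (2 * n + 1 + 1) := by
        rw [← zpow_add₀ hq0, ← zpow_natCast]; congr 1; push_cast; ring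
      have h2 : q ^ (10 * j ^ 2 + j - 4 * j * s) *
          q ^ (((2 * n + 1 + 1 : ℕ) : ℤ) + 1 - (n + 1 - 5 * j + s)) =
          q ^ (10 * j ^ 2 + 6 * j - 4 * j * s + n + 2 - s) := by
        rw [← zpow_add₀ hq0]; congr 1; push_cast; ring
      linear_combination (q ^ (10 * j ^ 2 + j - 4 * j * s) *
        qBinom q (2 * n + 1) (n - 5 * j + s)) * h1 +
          qBinom q (2 * n + 1) (n - 1 - 5 * j + s) * h2
    · rw [show 2 * j + 1 + -1 = 2 * j by ring, hU0, hU1,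
        schurTerm_odd s _ j (n + 2) (by push_cast; omega),
        schurTerm_odd s _ j (n + 1) (by push_cast; omega),
        schurTerm_odd s _ j (n + 1) (by push_cast; omega), qBinom_succ hq (2 * n + 1 + 1),
        qBinom_succ' hq (2 * n + 1) ((n : ℤ) + 2 - 5 * j - 3 + s)]
      rw [show (n : ℤ) + 2 - 5 * j - 3 + s - 1 = n + 1 - 5 * j - 3 + s by ring,
        show (n : ℤ) + 2 - 5 * j - 3 + s = n - 1 - 5 * j + s by ring]
      have h1 : q ^ ((n : ℤ) - 1 - 5 * j + s) *
          q ^ (((2 * n + 1 : ℕ) : ℤ) + 1 - (n - 1 - 5 * j + s)) = q ^ (2 * n + 1 + 1) := by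
        rw [← zpow_add₀ hq0, ← zpow_natCast]; congr 1; push_cast; ring
      have h2 : q ^ (10 * j ^ 2 + 11 * j + 3 - 2 * (2 * j + 1) * s) *
          q ^ ((n : ℤ) - 1 - 5 * j + s) =
          q ^ (10 * j ^ 2 + 6 * j - 4 * j * s + n + 2 - s) := by
        rw [← zpow_add₀ hq0]; congr 1; ring
      linear_combination -(q ^ (10 * j ^ 2 + 11 * j + 3 - 2 * (2 * j + 1) * s) *
        qBinom q (2 * n + 1) (n + 1 - 5 * j - 3 + s)) * h1 -
          qBinom q (2 * n + 1) (n - 1 - 5 * j + s) * h2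

/-- Schur's recurrence. -/
lemma tsum_schurTerm_recurrence (hq : ‖q‖ < 1) (hq0 : q ≠ 0) (s : ℤ) (k : ℕ) :
    ∑' i, schurTerm q s (k + 2) i =
      ∑' i, schurTerm q s (k + 1) i + q ^ (k + 1) * ∑' i, schurTerm q s k i := by
  obtain ⟨U, d, hU, h⟩ := schurTerm_recurrence hq hq0 s k
  have hU' : HasSum (fun i => U (i + d)) (∑' i, U i) :=
    (Equiv.addRight d).hasSum_iff.mpr hU.hasSum
  refine HasSum.tsum_eq ?_
  refine ((((summable_schurTerm q s (k + 1)).hasSum.add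
    ((summable_schurTerm q s k).hasSum.mul_left (q ^ (k + 1)))).add
      (hU.hasSum.sub hU'))).of_eq h ?_
  ring

lemma garrettB_succ (q : ℂ) (k : ℕ) : garrettB q (k + 1) = ∑' i, schurTerm q 0 k i := by
  rw [garrettB, tsum_eq_finsum]
  · refine finsum_congr fun i => ?_
    rw [schurTerm]
    congr 2
    · simp
    · push_cast; ring_nf
  · exact hasFiniteSupport_schurTerm q _ k

/-- The shift `s` puts both families under one recurrence: `s = 1` raises the lower index by one and
turns `i(5i+1)/2` into `i(5i-3)/2`. -/
lemma garrettA_succ (q : ℂ) (k : ℕ) : garrettA q (k + 1) = ∑' i, schurTerm q 1 k i := by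
  rw [garrettA, tsum_eq_finsum]
  · refine finsum_congr fun i => ?_
    rw [schurTerm]
    congr 2
    · congr 1
      rw [show i * (5 * i + 1) = i * (5 * i - 3) + 2 * (2 * i) by ring,
        Int.add_mul_ediv_left _ _ two_ne_zero]
      ring
    · push_cast; omega
  · exact hasFiniteSupport_schurTerm q _ k

lemma garrettA_zero (q : ℂ) : garrettA q 0 = 1 := rfl

lemma garrettB_zero (q : ℂ) : garrettB q 0 = 0 := rfl

lemma garrettB_one (hq : ‖q‖ < 1) : garrettB q 1 = 1 := by
  rw [garrettB_succ, tsum_eq_single 0]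
  · simp [schurTerm, qBinom_zero_right hq]
  · intro i hi
    rw [schurTerm, qBinom_eq_zero (by push_cast; omega), mul_zero]

lemma garrettB_two (hq : ‖q‖ < 1) : garrettB q 2 = 1 := by
  rw [garrettB_succ, tsum_eq_single 0]
  · simp [schurTerm, qBinom_zero_right hq]
  · intro i hi
    rw [schurTerm, qBinom_eq_zero (by push_cast; omega), mul_zero]

lemma garrettA_one (q : ℂ) : garrettA q 1 = 0 := by
  rw [garrettA_succ]
  refine (tsum_congr fun i => ?_).trans tsum_zero
  rw [schurTerm, qBinom_eq_zero (by push_cast; omega), mul_zero]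

lemma garrettA_two (hq : ‖q‖ < 1) : garrettA q 2 = 1 := by
  rw [garrettA_succ, tsum_eq_single 0]
  · have := qBinom_self hq 1
    simpa [schurTerm] using this
  · intro i hi
    rw [schurTerm, qBinom_eq_zero (by push_cast; omega), mul_zero]

/-- The value `a_0 = 1` is not given by the sum over `ℤ`; it is the one that extends the recurrence
down to `k = 0`. -/
lemma garrettA_recurrence (hq : ‖q‖ < 1) (hq0 : q ≠ 0) (k : ℕ) :
    garrettA q (k + 2) = garrettA q (k + 1) + q ^ k * garrettA q k := by
  cases k with
  | zero =>
    rw [zero_add, zero_add, garrettA_one, garrettA_two hq]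
    simp [garrettA]
  | succ k =>
    rw [garrettA_succ, garrettA_succ, garrettA_succ, tsum_schurTerm_recurrence hq hq0]

lemma garrettB_recurrence (hq : ‖q‖ < 1) (hq0 : q ≠ 0) (k : ℕ) :
    garrettB q (k + 2) = garrettB q (k + 1) + q ^ k * garrettB q k := by
  cases k with
  | zero =>
    rw [zero_add, zero_add, garrettB_one hq, garrettB_two hq]
    simp [garrettB]
  | succ k =>
    rw [garrettB_succ, garrettB_succ, garrettB_succ, tsum_schurTerm_recurrence hq hq0]

end Schur

/-! ### The Jacobi triple product -/

section TripleProduct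

variable {q : ℂ}

lemma exists_norm_qBinom_le (hq : ‖q‖ < 1) : ∃ C : ℝ, 0 < C ∧ ∀ n j, ‖qBinom q n j‖ ≤ C := by
  obtain ⟨A, hA0, hA⟩ := exists_norm_qPoch_le hq q
  obtain ⟨B, hB0, hB⟩ := exists_norm_qPoch_inv_le hq (mul_pow_ne_one hq hq)
  refine ⟨A * (B * B), by positivity, fun n j => ?_⟩
  rw [qBinom]
  split_ifs
  · rw [div_eq_mul_inv, mul_inv, norm_mul, norm_mul]
    gcongr
    exacts [hA _, hB _, hB _]
  · rw [norm_zero]; positivity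

lemma tendsto_qBinom (hq : ‖q‖ < 1) {n : ℕ → ℕ} {j : ℕ → ℤ} (hj : Tendsto j atTop atTop)
    (hn : Tendsto (fun l => (n l : ℤ) - j l) atTop atTop) :
    Tendsto (fun l => qBinom q (n l) (j l)) atTop (𝓝 (qPochInf q q)⁻¹) := by
  have hN : Tendsto Int.toNat atTop atTop :=
    tendsto_atTop.mpr fun b => by
      filter_upwards [eventually_ge_atTop (b : ℤ)] with a ha
      omega
  have hnn : Tendsto n atTop atTop := by
    refine ((hN.comp (hj.atTop_add_atTop hn))).congr fun l => ?_
    simp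
  have h0 := qPochInf_self_ne_zero hq
  have hlim := ((tendsto_qPoch hq q).comp hnn).div
    (((tendsto_qPoch hq q).comp (hN.comp hj)).mul ((tendsto_qPoch hq q).comp (hN.comp hn)))
    (mul_ne_zero h0 h0)
  rw [div_mul_cancel_left₀ h0] at hlim
  refine hlim.congr' ?_
  filter_upwards [hj.eventually_ge_atTop 0, hn.eventually_ge_atTop 0] with l h1 h2
  rw [qBinom, if_pos ⟨h1, by omega⟩]
  have e : ((n l : ℤ) - j l).toNat = n l - (j l).toNat := by omega
  simp [e]

/-- Dominated convergence: `q`-binomials are uniformly bounded, and tend to `1/(q;q)_∞` once the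
lower index and its complement both go to infinity. -/
lemma tendsto_tsum_mul_qBinom (hq : ‖q‖ < 1) {c : ℤ → ℂ} (hc : Summable fun i => ‖c i‖)
    {n : ℕ → ℕ} {j : ℤ → ℕ → ℤ} (hj : ∀ i, Tendsto (j i) atTop atTop)
    (hn : ∀ i, Tendsto (fun l => (n l : ℤ) - j i l) atTop atTop) :
    Tendsto (fun l => ∑' i, c i * qBinom q (n l) (j i l)) atTop
      (𝓝 ((∑' i, c i) * (qPochInf q q)⁻¹)) := by
  obtain ⟨C, hC0, hC⟩ := exists_norm_qBinom_le hq
  rw [← tsum_mul_right]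
  refine tendsto_tsum_of_dominated_convergence (hc.mul_right C)
    (fun i => (tendsto_qBinom hq (hj i) (hn i)).const_mul _) (.of_forall fun l i => ?_)
  rw [norm_mul]
  gcongr
  exact hC _ _

/-- The general term of the theta series. -/
noncomputable def thetaTerm (p z : ℂ) (i : ℤ) : ℂ := (-1) ^ i * p ^ (i * (i - 1) / 2) * z ^ i

lemma thetaTerm_succ {p z : ℂ} (hp : p ≠ 0) (hz : z ≠ 0) (i : ℤ) :
    thetaTerm p z (i + 1) = -(p ^ i * z * thetaTerm p z i) := by
  have e : (i + 1) * (i + 1 - 1) / 2 = i * (i - 1) / 2 + i := by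
    rw [show (i + 1) * (i + 1 - 1) = i * (i - 1) + 2 * i by ring,
      Int.add_mul_ediv_left _ _ two_ne_zero]
  rw [thetaTerm, thetaTerm, e, zpow_add₀ hp, zpow_add_one₀ hz, zpow_add_one₀ (by norm_num)]
  ring

lemma summable_norm_thetaTerm {p z : ℂ} (hp : ‖p‖ < 1) (hp0 : p ≠ 0) :
    Summable fun i => ‖thetaTerm p z i‖ := by
  have hchoose : ∀ n : ℕ, ((n.choose 2 : ℕ) : ℤ) = (n : ℤ) * (n - 1) / 2 := fun n => by
    rw [Nat.choose_two_right]
    cases n with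
    | zero => rfl
    | succ n => push_cast; simp
  refine .of_nat_of_neg ?_ ?_
  · refine (summable_pow_choose_two_mul_pow (norm_nonneg p) hp ‖z‖).congr fun n => ?_
    rw [thetaTerm, ← hchoose]
    simp
  · refine (summable_pow_choose_two_mul_pow (norm_nonneg p) hp ‖p * z⁻¹‖).congr fun n => ?_
    have e : (-(n : ℤ)) * (-n - 1) / 2 = (n.choose 2 : ℕ) + n := by
      rw [hchoose, show (-(n : ℤ)) * (-n - 1) = n * (n - 1) + 2 * n by ring,
        Int.add_mul_ediv_left _ _ two_ne_zero]
    rw [thetaTerm, e, zpow_add₀ hp0]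
    simp [mul_pow]
    ring

/-- The finite form of the Jacobi triple product identity. -/
lemma hasSum_thetaTerm_mul_qBinom {p z : ℂ} (hp : ‖p‖ < 1) (hp0 : p ≠ 0) (hz : z ≠ 0) (m n : ℕ) :
    HasSum (fun i : ℤ => thetaTerm p z i * qBinom p (m + n) (n + i))
      (qPoch z p m * qPoch (p / z) p n) := by
  induction m with
  | zero =>
    induction n with
    | zero =>
      have := hasSum_single (f := fun i : ℤ => thetaTerm p z i * qBinom p (0 + 0) ((0 : ℕ) + i)) 0
        fun i hi => by rw [qBinom_eq_zero (by push_cast; omega), mul_zero]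
      simpa [thetaTerm, qBinom_zero_right hp] using this
    | succ n ih =>
      -- The new factor `1 - p^(n+1)/z` adds a multiple of the sum shifted by one index; Pascal's
      -- rule merges the two.
      have hsh := (Equiv.addRight (1 : ℤ)).hasSum_iff.mpr ih
      refine (ih.add (hsh.mul_left (-(p ^ (n + 1) / z)))).of_eq (fun i => ?_) ?_
      · simp only [Function.comp, Equiv.coe_addRight]
        rw [← add_assoc 0 n 1, qBinom_succ hp, thetaTerm_succ hp0 hz,
          show ((n + 1 : ℕ) : ℤ) + i - 1 = n + i by push_cast; ring,
          show (n : ℤ) + (i + 1) = (n + 1 : ℕ) + i by push_cast; ring, zpow_add₀ hp0, zpow_natCast]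
        field_simp
      · rw [qPoch_succ (p / z)]
        ring
  | succ m ih =>
    have hsh := (Equiv.addRight (-1 : ℤ)).hasSum_iff.mpr ih
    refine (ih.add (hsh.mul_left (-(z * p ^ m)))).of_eq (fun i => ?_) ?_
    · simp only [Function.comp, Equiv.coe_addRight]
      obtain ⟨i, rfl⟩ : ∃ j, i = j + 1 := ⟨i - 1, by ring⟩
      rw [show m + 1 + n = m + n + 1 by ring, qBinom_succ' hp, thetaTerm_succ hp0 hz,
        add_neg_cancel_right, ← add_assoc (n : ℤ) i 1, add_sub_cancel_right]
      have e : p ^ i * p ^ (((m + n : ℕ) : ℤ) + 1 - (n + i + 1)) = p ^ m := by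
        rw [← zpow_add₀ hp0, ← zpow_natCast]
        congr 1
        push_cast; ring
      linear_combination -(z * thetaTerm p z i * qBinom p (m + n) (n + i)) * e
    · rw [qPoch_succ z]
      ring

/-- The Jacobi triple product identity. -/
lemma tsum_thetaTerm {p z : ℂ} (hp : ‖p‖ < 1) (hp0 : p ≠ 0) (hz : z ≠ 0) :
    ∑' i, thetaTerm p z i = qPochInf p p * (qPochInf z p * qPochInf (p / z) p) := by
  have h1 := tendsto_tsum_mul_qBinom hp (summable_norm_thetaTerm (z := z) hp hp0)
    (n := fun l => l + l) (j := fun i l => l + i)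
    (fun i => tendsto_atTop_add_const_right _ _ tendsto_natCast_atTop_atTop)
    (fun i => (tendsto_atTop_add_const_right _ (-i) tendsto_natCast_atTop_atTop).congr
      fun l => by push_cast; ring)
  have h2 := (tendsto_qPoch hp z).mul (tendsto_qPoch hp (p / z))
  have := tendsto_nhds_unique h1
    (h2.congr fun l => ((hasSum_thetaTerm_mul_qBinom hp hp0 hz l l).tsum_eq).symm)
  rw [← this, mul_comm (tsum _), mul_inv_cancel_left₀ (qPochInf_self_ne_zero hp)]

end TripleProduct

/-! ### Rogers-Ramanujan and Garrett-Ismail-Stanton identities -/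

section RogersRamanujan

variable {q : ℂ}

/-- The Rogers-Ramanujan type series `∑ q^(n^2 + m n) / (q; q)_n`. -/
noncomputable def rogersRamanujanSum (q : ℂ) (m : ℕ) : ℂ :=
  ∑' n : ℕ, q ^ (n ^ 2 + m * n) / qPoch q q n

lemma exists_rogersRamanujan_bound (hq : ‖q‖ < 1) : ∃ B : ℝ,
    (Summable fun n : ℕ => ‖q‖ ^ (n ^ 2) * B) ∧
      ∀ m n : ℕ, ‖q ^ (n ^ 2 + m * n) / qPoch q q n‖ ≤ ‖q‖ ^ (n ^ 2) * B := by
  obtain ⟨B, hB0, hB⟩ := exists_norm_qPoch_inv_le hq (mul_pow_ne_one hq hq)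
  refine ⟨B, ?_, fun m n => ?_⟩
  · simpa using (summable_pow_sq_mul_pow hq 1).mul_right B
  · rw [div_eq_mul_inv, norm_mul, norm_pow]
    gcongr ?_ * ?_
    · exact pow_le_pow_of_le_one (norm_nonneg _) hq.le (by omega)
    · exact hB n

lemma summable_rogersRamanujan (hq : ‖q‖ < 1) (m : ℕ) :
    Summable fun n : ℕ => q ^ (n ^ 2 + m * n) / qPoch q q n := by
  obtain ⟨B, hB, h⟩ := exists_rogersRamanujan_bound hq
  exact .of_norm_bounded hB (h m)

/-- In the termwise difference the factor `1 - q^n` kills the term `n = 0` and cancels the last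
factor of `(q)_n` otherwise; then `n` is shifted. -/
lemma rogersRamanujanSum_recurrence (hq : ‖q‖ < 1) (m : ℕ) :
    rogersRamanujanSum q m =
      rogersRamanujanSum q (m + 1) + q ^ (m + 1) * rogersRamanujanSum q (m + 2) := by
  have h0 := summable_rogersRamanujan hq m
  have h1 := summable_rogersRamanujan hq (m + 1)
  have e := (h0.sub h1).tsum_eq_zero_add
  have key : ∀ n : ℕ, q ^ ((n + 1) ^ 2 + m * (n + 1)) / qPoch q q (n + 1) -
      q ^ ((n + 1) ^ 2 + (m + 1) * (n + 1)) / qPoch q q (n + 1) =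
      q ^ (m + 1) * (q ^ (n ^ 2 + (m + 2) * n) / qPoch q q n) := by
    intro n
    have h0' : 1 - q * q ^ n ≠ 0 := sub_ne_zero.mpr (mul_pow_ne_one hq hq n).symm
    have hd : (1 - q * q ^ n) / (1 - q * q ^ n) = 1 := div_self h0'
    rw [qPoch_succ, ← sub_div, show q ^ ((n + 1) ^ 2 + m * (n + 1)) -
      q ^ ((n + 1) ^ 2 + (m + 1) * (n + 1)) =
        q ^ (m + 1) * q ^ (n ^ 2 + (m + 2) * n) * (1 - q * q ^ n) by ring, mul_div_mul_comm, hd]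
    ring
  simp only [key] at e
  rw [h0.tsum_sub h1, tsum_mul_left] at e
  simp only [ne_eq, OfNat.ofNat_ne_zero, not_false_eq_true, zero_pow, mul_zero, add_zero,
    sub_self, zero_add] at e
  rw [rogersRamanujanSum, rogersRamanujanSum, rogersRamanujanSum]
  linear_combination e

lemma tendsto_rogersRamanujanSum (hq : ‖q‖ < 1) :
    Tendsto (rogersRamanujanSum q) atTop (𝓝 1) := by
  obtain ⟨B, hB, h⟩ := exists_rogersRamanujan_bound hq
  have := tendsto_tsum_of_dominated_convergence (𝓕 := atTop)
    (g := fun n : ℕ => if n = 0 then (1 : ℂ) else 0) hB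
    (f := fun m n : ℕ => q ^ (n ^ 2 + m * n) / qPoch q q n) (fun n => ?_) (.of_forall h)
  · rwa [tsum_ite_eq] at this
  · rcases n with _ | n
    · simp
    · have h1 : Tendsto (fun m : ℕ => m * (n + 1)) atTop atTop :=
        tendsto_id.atTop_mul_const' (Nat.succ_pos n)
      have h2 := (tendsto_pow_atTop_nhds_zero_of_norm_lt_one hq).comp h1
      have h3 := (h2.const_mul (q ^ ((n + 1) ^ 2))).div_const (qPoch q q (n + 1))
      simpa [pow_add, Function.comp_def] using h3

/-- The limit of a solution of Schur's recurrence, in terms of its initial values. -/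
lemma limit_of_schur_recurrence (hq : ‖q‖ < 1) {f : ℕ → ℂ} {L : ℂ}
    (hf : ∀ k, f (k + 2) = f (k + 1) + q ^ k * f k) (hL : Tendsto f atTop (𝓝 L)) :
    rogersRamanujanSum q 0 * f 1 + rogersRamanujanSum q 1 * f 0 = L := by
  -- The recurrences of `G` and `f` are adjoint, so this pairing is constant in `m`; as `m → ∞` it
  -- tends to `L` because `G_m → 1`.
  have inv : ∀ m, rogersRamanujanSum q m * f (m + 1) + q ^ m * (rogersRamanujanSum q (m + 1) * f m) =
      rogersRamanujanSum q 0 * f 1 + rogersRamanujanSum q 1 * f 0 := by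
    intro m
    induction m with
    | zero => simp
    | succ m ih =>
      rw [← ih, hf m, rogersRamanujanSum_recurrence hq m]
      ring
  have hG := tendsto_rogersRamanujanSum hq
  have h1 := (hG.mul (hL.comp (tendsto_add_atTop_nat 1))).add
    ((tendsto_pow_atTop_nhds_zero_of_norm_lt_one hq).mul
      ((hG.comp (tendsto_add_atTop_nat 1)).mul hL))
  rw [zero_mul, one_mul, add_zero] at h1
  exact tendsto_nhds_unique (tendsto_const_nhds.congr fun m => (inv m).symm) h1

/-- `i(5i+1)/2 - 2is = 5 i(i-1)/2 + (3-2s) i`, a theta exponent in base `q^5`. -/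
lemma schurTerm_eq (hq0 : q ≠ 0) (s : ℤ) (k : ℕ) (i : ℤ) :
    schurTerm q s k i =
      thetaTerm (q ^ 5) (q ^ (3 - 2 * s)) i * qBinom q k ((k - 5 * i) / 2 + s) := by
  rw [schurTerm, thetaTerm, mul_assoc ((-1) ^ i) ((q ^ 5) ^ _), ← zpow_natCast q 5, ← zpow_mul, ← zpow_mul,
    ← zpow_add₀ hq0]
  congr 3
  obtain ⟨t, ht⟩ := (Int.even_mul_pred_self i).two_dvd
  rw [ht, Int.mul_ediv_cancel_left _ two_ne_zero,
    show i * (5 * i + 1) = 2 * (5 * t + 3 * i) by linear_combination 5 * ht,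
    Int.mul_ediv_cancel_left _ two_ne_zero]
  push_cast; ring

lemma tendsto_tsum_schurTerm (hq : ‖q‖ < 1) (hq0 : q ≠ 0) (s : ℤ) :
    Tendsto (fun k => ∑' i, schurTerm q s k i) atTop
      (𝓝 ((∑' i, thetaTerm (q ^ 5) (q ^ (3 - 2 * s)) i) * (qPochInf q q)⁻¹)) := by
  have h5 : ‖q ^ 5‖ < 1 := by
    rw [norm_pow]; exact pow_lt_one₀ (norm_nonneg _) hq (by norm_num)
  simp only [schurTerm_eq hq0]
  refine tendsto_tsum_mul_qBinom hq (summable_norm_thetaTerm h5 (pow_ne_zero 5 hq0))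
    (n := fun k => k) (j := fun i k => (k - 5 * i) / 2 + s) (fun i => ?_) (fun i => ?_)
  all_goals
    refine tendsto_atTop.mpr fun b => ?_
    filter_upwards [eventually_ge_atTop (2 * |b| + 5 * |i| + 2 * |s| + 10).toNat] with k hk
    have := le_abs_self b
    have := le_abs_self s
    have := neg_abs_le s
    have := le_abs_self i
    have := neg_abs_le i
    omega

lemma qPochInf_pow_dissection (hq : ‖q‖ < 1) :
    qPochInf q q = qPochInf q (q ^ 5) * qPochInf (q ^ 2) (q ^ 5) * qPochInf (q ^ 3) (q ^ 5) *
      qPochInf (q ^ 4) (q ^ 5) * qPochInf (q ^ 5) (q ^ 5) := by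
  have h5 : ‖q ^ 5‖ < 1 := by
    rw [norm_pow]; exact pow_lt_one₀ (norm_nonneg _) hq (by norm_num)
  have t := tendsto_qPoch h5
  have h1 := ((((t q).mul (t (q ^ 2))).mul (t (q ^ 3))).mul (t (q ^ 4))).mul (t (q ^ 5))
  have h2 := (tendsto_qPoch hq q).comp
    (tendsto_id.const_mul_atTop' (show 0 < 5 by norm_num) : Tendsto (fun n : ℕ => 5 * n) atTop atTop)
  refine tendsto_nhds_unique h2 (h1.congr fun n => ?_)
  simp only [Function.comp]
  induction n with
  | zero => simp
  | succ n ih =>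
    rw [mul_add, mul_one, qPoch_succ q q (5 * n + 4), qPoch_succ q q (5 * n + 3),
      qPoch_succ q q (5 * n + 2), qPoch_succ q q (5 * n + 1), qPoch_succ q q (5 * n), ← ih]
    simp only [qPoch_succ _ (q ^ 5), ← pow_mul]
    ring

/-- The triple product gives the residues `0, 2, 3` mod `5`; dividing by `(q;q)_∞` leaves `1, 4` in
the denominator. -/
lemma garrettB_limit (hq : ‖q‖ < 1) (hq0 : q ≠ 0) :
    Tendsto (garrettB q) atTop (𝓝 (qPochInf q (q ^ 5) * qPochInf (q ^ 4) (q ^ 5))⁻¹) := by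
  have h5 : ‖q ^ 5‖ < 1 := by
    rw [norm_pow]; exact pow_lt_one₀ (norm_nonneg _) hq (by norm_num)
  have h := tendsto_tsum_schurTerm hq hq0 0
  have e : q ^ ((3 : ℤ) - 2 * 0) = q ^ 3 := by norm_cast
  have hne := qPochInf_self_ne_zero hq
  rw [e, tsum_thetaTerm h5 (pow_ne_zero 5 hq0) (pow_ne_zero 3 hq0)] at h
  rw [← tendsto_add_atTop_iff_nat 1]
  have e' : q ^ 5 / q ^ 3 = q ^ 2 := by field_simp
  simp only [garrettB_succ]
  convert h using 2
  rw [e']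
  rw [qPochInf_pow_dissection hq] at hne ⊢
  simp only [mul_ne_zero_iff] at hne
  obtain ⟨⟨⟨⟨h1, h2⟩, h3⟩, h4⟩, h5⟩ := hne
  field_simp

lemma garrettA_limit (hq : ‖q‖ < 1) (hq0 : q ≠ 0) :
    Tendsto (garrettA q) atTop (𝓝 (qPochInf (q ^ 2) (q ^ 5) * qPochInf (q ^ 3) (q ^ 5))⁻¹) := by
  have h5 : ‖q ^ 5‖ < 1 := by
    rw [norm_pow]; exact pow_lt_one₀ (norm_nonneg _) hq (by norm_num)
  have h := tendsto_tsum_schurTerm hq hq0 1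
  have e : q ^ ((3 : ℤ) - 2 * 1) = q := by norm_num
  have hne := qPochInf_self_ne_zero hq
  rw [e, tsum_thetaTerm h5 (pow_ne_zero 5 hq0) hq0] at h
  rw [← tendsto_add_atTop_iff_nat 1]
  have e' : q ^ 5 / q = q ^ 4 := by field_simp
  simp only [garrettA_succ]
  convert h using 2
  rw [e']
  rw [qPochInf_pow_dissection hq] at hne ⊢
  simp only [mul_ne_zero_iff] at hne
  obtain ⟨⟨⟨⟨h1, h2⟩, h3⟩, h4⟩, h5⟩ := hne
  field_simp

/-- The first Rogers-Ramanujan identity. -/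
lemma rogersRamanujanSum_zero (hq : ‖q‖ < 1) (hq0 : q ≠ 0) :
    rogersRamanujanSum q 0 = (qPochInf q (q ^ 5) * qPochInf (q ^ 4) (q ^ 5))⁻¹ := by
  have := limit_of_schur_recurrence hq (garrettB_recurrence hq hq0) (garrettB_limit hq hq0)
  simpa only [garrettB_one hq, garrettB_zero, mul_one, mul_zero, add_zero] using this

/-- The second Rogers-Ramanujan identity. -/
lemma rogersRamanujanSum_one (hq : ‖q‖ < 1) (hq0 : q ≠ 0) :
    rogersRamanujanSum q 1 = (qPochInf (q ^ 2) (q ^ 5) * qPochInf (q ^ 3) (q ^ 5))⁻¹ := by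
  have := limit_of_schur_recurrence hq (garrettA_recurrence hq hq0) (garrettA_limit hq hq0)
  simpa only [garrettA_one, garrettA_zero, mul_one, mul_zero, zero_add] using this

/-- The Garrett-Ismail-Stanton identity. -/
lemma rogersRamanujanSum_eq_garrett (hq : ‖q‖ < 1) (hq0 : q ≠ 0) (m : ℕ) :
    (-1) ^ m * q ^ m.choose 2 * rogersRamanujanSum q m =
      garrettA q m / (qPochInf q (q ^ 5) * qPochInf (q ^ 4) (q ^ 5)) -
        garrettB q m / (qPochInf (q ^ 2) (q ^ 5) * qPochInf (q ^ 3) (q ^ 5)) := by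
  rw [div_eq_mul_inv, div_eq_mul_inv, ← rogersRamanujanSum_zero hq hq0,
    ← rogersRamanujanSum_one hq hq0]
  -- The factor `(-1)^m q^(binom(m,2))` turns the recurrence of `G` into Schur's, so agreement at `m
  -- = 0, 1` suffices.
  induction m using Nat.twoStepInduction with
  | zero => simp [garrettA, garrettB]
  | one => simp [garrettA_one, garrettB_one hq]
  | more m h1 h2 =>
    have hc : ∀ k : ℕ, (k + 1).choose 2 = k + k.choose 2 := fun k => by
      rw [Nat.choose_succ_succ' k 1, Nat.choose_one_right]
    rw [garrettA_recurrence hq hq0, garrettB_recurrence hq hq0, hc, hc]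
    rw [hc] at h2
    have hr := rogersRamanujanSum_recurrence hq m
    linear_combination h2 + q ^ m * h1 - (-1) ^ m * q ^ (m + m.choose 2) * hr

/-- `binom(2k,2) = 2 binom(k,2) + k^2`. One factor `q^(binom(k,2))` absorbs the negative power in
the expansion. -/
lemma garrett_combination_even (hq : ‖q‖ < 1) (hq0 : q ≠ 0) (k : ℕ) :
    garrettA q (2 * k) / (qPochInf q (q ^ 5) * qPochInf (q ^ 4) (q ^ 5)) -
        garrettB q (2 * k) / (qPochInf (q ^ 2) (q ^ 5) * qPochInf (q ^ 3) (q ^ 5)) =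
      q ^ k.choose 2 * q ^ k.choose 2 * q ^ (k ^ 2) * rogersRamanujanSum q (2 * k) := by
  rw [← rogersRamanujanSum_eq_garrett hq hq0, (even_two_mul k).neg_one_pow, one_mul, ← pow_add,
    ← pow_add]
  congr 2
  have hc : ∀ k : ℕ, (k + 1).choose 2 = k + k.choose 2 := fun k => by
    rw [Nat.choose_succ_succ' k 1, Nat.choose_one_right]
  induction k with
  | zero => rfl
  | succ k ih =>
    rw [mul_add, mul_one, hc, hc, hc, ih]
    ring

/-- The expansion in Garrett's polynomials of the `₁φ₂` series. -/
lemma hasSum_garrett (hq : ‖q‖ < 1) (hq0 : q ≠ 0) {w a : ℂ} (ha : ∀ k : ℕ, a * w * q ^ k ≠ 1) :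
    HasSum (fun k : ℕ =>
      (q ^ k.choose 2)⁻¹ * (qPoch w q k / (qPoch (a * w) q k * qPoch q q k)) * (-a) ^ k *
        (garrettA q (2 * k) / (qPochInf q (q ^ 5) * qPochInf (q ^ 4) (q ^ 5)) -
          garrettB q (2 * k) / (qPochInf (q ^ 2) (q ^ 5) * qPochInf (q ^ 3) (q ^ 5))))
      (∑' N : ℕ, q ^ (N ^ 2) * (qPoch a q N / (qPoch q q N * qPoch (a * w) q N))) := by
  obtain ⟨hS, e⟩ := hasSum_qChuVandermonde_double hq ha
  rw [e]
  refine hS.hasSum.prod_fiberwise fun k => ?_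
  rw [garrett_combination_even hq hq0]
  refine ((summable_rogersRamanujan hq (2 * k)).hasSum.mul_left (q ^ k.choose 2 * q ^ (k ^ 2) *
    (qPoch w q k / (qPoch (a * w) q k * qPoch q q k)) * (-a) ^ k)).of_eq (fun n => ?_) ?_
  · simp only [div_eq_mul_inv, mul_inv]
    ring
  · rw [← rogersRamanujanSum]
    have : q ^ k.choose 2 ≠ 0 := pow_ne_zero _ hq0
    field_simp

end RogersRamanujan

/-! ### Coefficientwise convergence and evaluation in the disc -/

section FormalSeries

open PowerSeries

lemma hasSum_monomial {ι : Type*} (e : ι → ℕ) {u : ι → ℂ} (hu : Summable fun i => ‖u i‖) :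
    HasSum (fun i => monomial (e i) (u i))
      (PowerSeries.mk fun d => ∑' i, if d = e i then u i else 0) := by
  refine (WithPiTopology.hasSum_iff_hasSum_coeff ℂ).mpr fun d => ?_
  simp only [coeff_monomial, coeff_mk]
  refine (Summable.of_norm_bounded hu fun i => ?_).hasSum
  split_ifs <;> simp

/-- Regrouping by degree. The fibres of `e` may be infinite, so summability of `u` itself is needed.
-/
lemma hasSum_monomial_eval {ι : Type*} (e : ι → ℕ) {u : ι → ℂ} (hu : Summable fun i => ‖u i‖)
    {a : ℂ} (ha : ‖a‖ < 1) :
    HasSum (fun d => (∑' i, if d = e i then u i else 0) * a ^ d) (∑' i, u i * a ^ e i) := by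
  have hs : Summable fun i => u i * a ^ e i := by
    refine .of_norm_bounded hu fun i => ?_
    rw [norm_mul, norm_pow]
    exact mul_le_of_le_one_right (norm_nonneg _) (pow_le_one₀ (norm_nonneg _) ha.le)
  have h : HasSum (fun p : Σ d, {i // e i = d} => u p.2 * a ^ e p.2) (∑' i, u i * a ^ e i) :=
    (Equiv.sigmaFiberEquiv e).hasSum_iff.mpr hs.hasSum
  refine HasSum.sigma (g := fun d => (∑' i, if d = e i then u i else 0) * a ^ d) h fun d => ?_
  have hfib : HasSum (fun i => (if d = e i then u i else 0) * a ^ d)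
      ((∑' i, if d = e i then u i else 0) * a ^ d) := by
    have hi : Summable fun i => if d = e i then u i else 0 :=
      Summable.of_norm_bounded hu fun i => by split_ifs <;> simp
    exact hi.hasSum.mul_right _
  have hind : HasSum ({i | e i = d}.indicator fun i => u i * a ^ e i)
      ((∑' i, if d = e i then u i else 0) * a ^ d) := by
    refine hfib.of_eq (fun i => ?_) rfl
    by_cases h : e i = d
    · rw [Set.indicator_of_mem (s := {i | e i = d}) h, if_pos h.symm, h]
    · rw [Set.indicator_of_notMem (s := {i | e i = d}) h, if_neg (Ne.symm h), zero_mul]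
  exact hasSum_subtype_iff_indicator.mpr hind

/-- Both are the Taylor series of `g` at `0`, which is unique. -/
lemma PowerSeries.eq_of_hasSum_eval {P Q : ℂ⟦X⟧} {g : ℂ → ℂ}
    (hP : ∀ a : ℂ, ‖a‖ < 1 → HasSum (fun d => coeff d P * a ^ d) (g a))
    (hQ : ∀ a : ℂ, ‖a‖ < 1 → HasSum (fun d => coeff d Q * a ^ d) (g a)) : P = Q := by
  have key : ∀ R : ℂ⟦X⟧, (∀ a : ℂ, ‖a‖ < 1 → HasSum (fun d => coeff d R * a ^ d) (g a)) →
      HasFPowerSeriesAt g (FormalMultilinearSeries.ofScalars ℂ fun d => coeff d R) 0 := by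
    intro R hR
    rw [hasFPowerSeriesAt_iff]
    filter_upwards [Metric.ball_mem_nhds (0 : ℂ) one_pos] with a ha
    simpa [FormalMultilinearSeries.coeff_ofScalars, mul_comm] using
      hR a (mem_ball_zero_iff.mp ha)
  have h := (key P hP).eq_formalMultilinearSeries (key Q hQ)
  ext d
  have := congrArg (fun p => FormalMultilinearSeries.coeff p d) h
  simpa [FormalMultilinearSeries.coeff_ofScalars] using this

lemma prod_X_mul_C (f : ℕ → ℂ) (t : Finset ℕ) :
    ∏ k ∈ t, ((X : ℂ⟦X⟧) * C (f k)) = monomial t.card (∏ k ∈ t, f k) := by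
  rw [Finset.prod_mul_distrib, Finset.prod_const, ← map_prod, X_pow_eq, ← monomial_zero_eq_C_apply,
    monomial_mul_monomial, add_zero, one_mul]

lemma summable_prod_X_mul_C {f : ℕ → ℂ} (hf : Summable fun k => ‖f k‖) :
    Summable fun t : Finset ℕ => ∏ k ∈ t, ((X : ℂ⟦X⟧) * C (f k)) := by
  simp only [prod_X_mul_C]
  exact (hasSum_monomial _ (summable_finsetProd_of_summable_norm hf).norm).summable

lemma multipliable_one_add_X_mul_C {f : ℕ → ℂ} (hf : Summable fun k => ‖f k‖) :
    Multipliable fun k => 1 + (X : ℂ⟦X⟧) * C (f k) :=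
  multipliable_one_add_of_summable_prod (summable_prod_X_mul_C hf)

lemma hasSum_tprod_one_add_X_mul_C {f : ℕ → ℂ} (hf : Summable fun k => ‖f k‖) :
    HasSum (fun t : Finset ℕ => monomial t.card (∏ k ∈ t, f k))
      (∏' k, (1 + (X : ℂ⟦X⟧) * C (f k))) := by
  have h := summable_prod_X_mul_C hf
  rw [tprod_one_add h]
  exact h.hasSum.of_eq (fun t => (prod_X_mul_C f t).symm) rfl

/-- A series of infinite products linear in the variable converges coefficientwise, and its sum can
be evaluated termwise in the unit disc. -/
lemma exists_hasSum_tprod_one_add_X_mul_C {r A : ℝ} (hr0 : 0 ≤ r) (hr : r < 1) {d : ℕ → ℂ}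
    (m : ℕ → ℕ) {f : ℕ → ℕ → ℂ} (hd : Summable fun n => ‖d n‖)
    (hf : ∀ n k, ‖f n k‖ ≤ A * r ^ k) :
    ∃ S : ℂ⟦X⟧, HasSum (fun n => C (d n) * X ^ m n * ∏' k, (1 + X * C (f n k))) S ∧
      ∀ a : ℂ, ‖a‖ < 1 → HasSum (fun j => coeff j S * a ^ j)
        (∑' n, d n * a ^ m n * ∏' k, (1 + a * f n k)) := by
  have hA : 0 ≤ A := by simpa using (norm_nonneg _).trans (hf 0 0)
  have hg : Summable fun k : ℕ => A * r ^ k := (summable_geometric_of_lt_one hr0 hr).mul_left A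
  have hfs : ∀ n, Summable fun k => ‖f n k‖ := fun n =>
    .of_nonneg_of_le (fun _ => norm_nonneg _) (hf n) hg
  have hgp := summable_finsetProd_of_summable_nonneg (fun k => by positivity) hg
  -- Each product expands over finite sets of factors, giving a single family of monomials; the
  -- bound on `f`, uniform in `n`, makes it absolutely summable.
  set u : ℕ × Finset ℕ → ℂ := fun p => d p.1 * ∏ k ∈ p.2, f p.1 k with hu
  have hus : Summable fun p => ‖u p‖ := by
    refine .of_nonneg_of_le (fun _ => norm_nonneg _) (fun p => ?_)
      (hd.mul_of_nonneg hgp (fun _ => norm_nonneg _)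
        (fun t => Finset.prod_nonneg fun k _ => by positivity))
    rw [hu, norm_mul, norm_prod]
    gcongr with k
    exact hf _ _
  set e : ℕ × Finset ℕ → ℕ := fun p => m p.1 + p.2.card with he
  refine ⟨_, (hasSum_monomial e hus).prod_fiberwise fun n => ?_, fun a ha => ?_⟩
  · refine ((hasSum_tprod_one_add_X_mul_C (hfs n)).mul_left (C (d n) * X ^ m n)).of_eq
      (fun t => ?_) rfl
    rw [X_pow_eq, ← monomial_zero_eq_C_apply, monomial_mul_monomial, monomial_mul_monomial,
      zero_add, mul_one]
  · have h := hasSum_monomial_eval e hus ha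
    have hs : Summable fun p => u p * a ^ e p := by
      refine .of_norm_bounded hus fun p => ?_
      rw [norm_mul, norm_pow]
      exact mul_le_of_le_one_right (norm_nonneg _) (pow_le_one₀ (norm_nonneg _) ha.le)
    have h2 : HasSum (fun n => d n * a ^ m n * ∏' k, (1 + a * f n k)) (∑' p, u p * a ^ e p) := by
      refine hs.hasSum.prod_fiberwise fun n => ?_
      have haf : Summable fun k => ‖a * f n k‖ := by
        simpa only [norm_mul] using (hfs n).mul_left ‖a‖
      have h3 := summable_finsetProd_of_summable_norm haf
      rw [tprod_one_add h3]
      refine (h3.hasSum.mul_left _).of_eq (fun t => ?_) rfl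
      rw [hu, he, Finset.prod_mul_distrib, Finset.prod_const, pow_add]
      ring
    rw [h2.tsum_eq]
    simpa only [coeff_mk] using h

variable {q : ℂ}

lemma one_sub_X_mul_C (w q : ℂ) (k : ℕ) :
    1 - (X : ℂ⟦X⟧) * C w * C q ^ k = 1 + X * C (-(w * q ^ k)) := by
  simp only [map_neg, map_mul, map_pow]
  ring

lemma qPochInf_X_mul_C (w q : ℂ) :
    qPochInf ((X : ℂ⟦X⟧) * C w) (C q) = ∏' k : ℕ, (1 + X * C (-(w * q ^ k))) := by
  simp only [qPochInf, one_sub_X_mul_C]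

lemma qPochInf_X_mul_C_split (hq : ‖q‖ < 1) (w : ℂ) (k : ℕ) :
    qPochInf ((X : ℂ⟦X⟧) * C w) (C q) =
      qPoch (X * C w) (C q) k * qPochInf (X * C (w * q ^ k)) (C q) := by
  have hT : ∀ v : ℂ, Tendsto (qPoch ((X : ℂ⟦X⟧) * C v) (C q)) atTop
      (𝓝 (qPochInf ((X : ℂ⟦X⟧) * C v) (C q))) := fun v => by
    rw [qPochInf_X_mul_C]
    refine (multipliable_one_add_X_mul_C (summable_neg_mul_pow hq v)).hasProd.tendsto_prod_nat.congr
      fun n => ?_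
    simp only [qPoch, one_sub_X_mul_C]
  refine tendsto_nhds_unique ((hT w).comp (tendsto_add_atTop_nat k))
    (((hT (w * q ^ k)).const_mul _).congr fun n => ?_)
  simp only [Function.comp]
  rw [add_comm n k, qPoch_add, map_mul, map_pow, mul_assoc X]

lemma qPochInf_mul_qPoch_inv (hq : ‖q‖ < 1) (w : ℂ) (k : ℕ) :
    qPochInf ((X : ℂ⟦X⟧) * C w) (C q) * (qPoch (X * C w) (C q) k)⁻¹ =
      qPochInf (X * C (w * q ^ k)) (C q) := by
  have h : constantCoeff (qPoch ((X : ℂ⟦X⟧) * C w) (C q) k) ≠ 0 := by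
    simp [qPoch, map_prod]
  rw [qPochInf_X_mul_C_split hq w k, mul_right_comm, PowerSeries.mul_inv_cancel _ h, one_mul]

/-- Padding with factors `1` brings the left side of the formal identity under the same lemma on
infinite products as the right side. -/
lemma qPoch_X_eq_tprod (q : ℂ) (n : ℕ) :
    qPoch (X : ℂ⟦X⟧) (C q) n = ∏' k : ℕ, (1 + X * C (if k < n then -q ^ k else 0)) := by
  rw [tprod_eq_prod (s := Finset.range n) fun k hk => by
    rw [Finset.mem_range] at hk; simp [hk]]
  refine Finset.prod_congr rfl fun k hk => ?_
  rw [if_pos (Finset.mem_range.mp hk)]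
  simp [sub_eq_add_neg]

lemma qPoch_eq_tprod (a q : ℂ) (n : ℕ) :
    qPoch a q n = ∏' k : ℕ, (1 + a * (if k < n then -q ^ k else 0)) := by
  rw [tprod_eq_prod (s := Finset.range n) fun k hk => by
    rw [Finset.mem_range] at hk; simp [hk]]
  refine Finset.prod_congr rfl fun k hk => ?_
  rw [if_pos (Finset.mem_range.mp hk)]
  ring

/-- Divisibility by `X^k` leaves finitely many terms in each degree, so no growth condition on `c`
is needed. -/
lemma summable_formalTerm (q x y z : ℂ) (c : ℕ → ℂ) : Summable (formalTerm q x y z c) := by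
  refine (WithPiTopology.summable_iff_summable_coeff ℂ).mpr fun d =>
    summable_of_ne_finset_zero (s := Finset.range (d + 1)) fun k hk => ?_
  rw [Finset.mem_range, not_lt] at hk
  rw [formalTerm, ← mul_neg, mul_comm, mul_pow, mul_assoc, coeff_X_pow_mul', if_neg (by omega)]

end FormalSeries

/-! ### The complex and the formal expansion -/

lemma hasSum_stieltjesWigert_garrett {q x y z a : ℂ} (hq : ‖q‖ < 1) (hzx : ‖z * x‖ < 1)
    (hq0 : q ≠ 0) (hyz : y * z = 1) (ha : ∀ k : ℕ, a * z * x * q ^ k ≠ 1) :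
    ∃ T : ℂ,
      HasSum (fun k : ℕ =>
        (q ^ k.choose 2)⁻¹ * (qPoch (z * x) q k / (qPoch (a * z * x) q k * qPoch q q k)) *
          (-(a * z * y)) ^ k *
          (garrettA q (2 * k) / (qPochInf q (q ^ 5) * qPochInf (q ^ 4) (q ^ 5)) -
            garrettB q (2 * k) / (qPochInf (q ^ 2) (q ^ 5) * qPochInf (q ^ 3) (q ^ 5)))) T ∧
      HasSum (fun n : ℕ => stieltjesWigert n x y q * (qPoch a q n / qPoch q q n) * z ^ n)
        (qPochInf (a * z * x) q / qPochInf (z * x) q * T) := by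
  have h := (hasSum_stieltjesWigert (y := y) hq hzx ha).1
  rw [mul_assoc a z x] at *
  have hg := hasSum_garrett hq hq0 (w := z * x) (a := a) (by simpa only [mul_assoc] using ha)
  simp only [hyz, one_pow, mul_one] at h
  refine ⟨_, hg.of_eq (fun k => ?_) rfl, h⟩
  rw [mul_assoc a z y, mul_comm z y, hyz, mul_one]

lemma summable_stieltjesWigert_coeff {q x z : ℂ} (hq : ‖q‖ < 1) (hzx : ‖z * x‖ < 1) (y : ℂ) :
    Summable fun n : ℕ => stieltjesWigert n x y q / qPoch q q n * z ^ n := by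
  refine (hasSum_stieltjesWigert (y := y) (a := 0) hq hzx (by simp)).1.summable.congr fun n => ?_
  rw [qPoch_zero_left, mul_one_div]

-- The generating series `S` and the unseparated expansion `S'` have the same values on `|a| < 1`,
-- hence coincide. Only then is `S'` split, inside `ℂ⟦X⟧`.
open PowerSeries in
lemma hasSum_formal_garrett {q x y z : ℂ} (hq : ‖q‖ < 1) (hzx : ‖z * x‖ < 1)
    (hq0 : q ≠ 0) (hyz : y * z = 1) :
    HasSum (fun n : ℕ => C (stieltjesWigert n x y q / qPoch q q n * z ^ n) * qPoch X (C q) n)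
      (C (qPochInf (z * x) q * (qPochInf q (q ^ 5) * qPochInf (q ^ 4) (q ^ 5)))⁻¹ *
          qPochInf (X * C (z * x)) (C q) * (∑' k, formalTerm q x y z (garrettA q) k) -
        C (qPochInf (z * x) q * (qPochInf (q ^ 2) (q ^ 5) * qPochInf (q ^ 3) (q ^ 5)))⁻¹ *
          qPochInf (X * C (z * x)) (C q) * ∑' k, formalTerm q x y z (garrettB q) k) := by
  set w := z * x with hw
  set α := qPochInf q (q ^ 5) * qPochInf (q ^ 4) (q ^ 5) with hα
  set β := qPochInf (q ^ 2) (q ^ 5) * qPochInf (q ^ 3) (q ^ 5) with hβ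
  set H : ℕ → ℂ := fun k => garrettA q (2 * k) / α - garrettB q (2 * k) / β with hH
  -- The scalar left in the `k`-th term once `(Xw)_∞ / (Xw)_k` is written as `(X w q^k)_∞`.
  set ε : ℕ → ℂ := fun k =>
    (qPochInf w q)⁻¹ * ((q ^ k.choose 2)⁻¹ * (qPoch w q k / qPoch q q k) * (-1) ^ k * H k) with hε
  have hwk : ∀ k : ℕ, ‖w * q ^ k‖ ≤ ‖q‖ ^ k := fun k => by
    rw [norm_mul, norm_pow]
    exact mul_le_of_le_one_left (by positivity) hzx.le
  obtain ⟨S, hS, hSe⟩ := exists_hasSum_tprod_one_add_X_mul_C (norm_nonneg q) hq (fun _ => 0)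
    (d := fun n => stieltjesWigert n x y q / qPoch q q n * z ^ n)
    (f := fun n k => if k < n then -q ^ k else 0) (A := 1)
    (summable_stieltjesWigert_coeff hq hzx y).norm
    (fun n k => by split_ifs <;> simp)
  have hεs : Summable fun k => ‖ε k‖ := by
    obtain ⟨M, hM0, hM⟩ := exists_norm_qPoch_le hq w
    -- At `a = 1`, admissible since `|w| < 1`, the complex expansion is `ε` up to the bounded factor
    -- `(w)_k` and a constant.
    have h1 := (hasSum_garrett hq hq0 (w := w) (a := 1)
      (by simpa using mul_pow_ne_one hq hzx)).summable.norm
    refine .of_nonneg_of_le (fun _ => norm_nonneg _) (fun k => ?_)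
      (h1.mul_left (‖(qPochInf w q)⁻¹‖ * M))
    have hne := qPoch_ne_zero (mul_pow_ne_one hq hzx) k
    have e : ε k = (qPochInf w q)⁻¹ * qPoch w q k * ((q ^ k.choose 2)⁻¹ *
        (qPoch w q k / (qPoch (1 * w) q k * qPoch q q k)) * (-1) ^ k * H k) := by
      simp only [hε, one_mul]
      field_simp
    rw [e, norm_mul, norm_mul]
    gcongr
    exact hM k
  obtain ⟨S', hS', hSe'⟩ := exists_hasSum_tprod_one_add_X_mul_C (norm_nonneg q) hq (fun k => k)
    (d := ε) (f := fun k i => -(w * q ^ k * q ^ i)) (A := 1) hεs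
    (fun k i => by
      rw [norm_neg, norm_mul, one_mul, norm_pow]
      exact mul_le_of_le_one_left (by positivity)
        ((hwk k).trans (pow_le_one₀ (norm_nonneg _) hq.le)))
  have hSS : S = S' := by
    refine PowerSeries.eq_of_hasSum_eval hSe fun a ha => ?_
    convert hSe' a ha using 1
    have haw : ∀ k : ℕ, a * z * x * q ^ k ≠ 1 := by
      refine mul_pow_ne_one hq ?_
      rw [mul_assoc, norm_mul]
      exact mul_lt_one_of_nonneg_of_lt_one_left (norm_nonneg _) ha hzx.le
    obtain ⟨T, hT, hL⟩ := hasSum_stieltjesWigert_garrett hq hzx hq0 hyz haw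
    have e1 : ∑' n : ℕ, stieltjesWigert n x y q / qPoch q q n * z ^ n * a ^ 0 *
        ∏' k : ℕ, (1 + a * (if k < n then -q ^ k else 0)) =
        qPochInf (a * z * x) q / qPochInf (z * x) q * T := by
      rw [← hL.tsum_eq]
      refine tsum_congr fun n => ?_
      rw [← qPoch_eq_tprod]
      ring
    rw [e1, ← hT.tsum_eq, ← tsum_mul_left]
    refine tsum_congr fun k => ?_
    have e2 : ∏' i : ℕ, (1 + a * -(w * q ^ k * q ^ i)) = qPochInf (a * z * x * q ^ k) q := by
      rw [qPochInf]
      refine tprod_congr fun i => ?_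
      rw [hw]; ring
    rw [e2, qPochInf_split hq _ k, mul_assoc a z y, mul_comm z y, hyz, mul_one, neg_pow a]
    have hne := qPoch_ne_zero haw k
    simp only [hε, hH, hα, hβ, hw]
    field_simp
  have hU := (summable_formalTerm q x y z (garrettA q)).hasSum.mul_left
    (C (qPochInf w q * α)⁻¹ * qPochInf (X * C w) (C q))
  have hV := (summable_formalTerm q x y z (garrettB q)).hasSum.mul_left
    (C (qPochInf w q * β)⁻¹ * qPochInf (X * C w) (C q))
  have hterm : ∀ k, C (ε k) * X ^ k * ∏' i : ℕ, (1 + X * C (-(w * q ^ k * q ^ i))) =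
      C (qPochInf w q * α)⁻¹ * qPochInf (X * C w) (C q) * formalTerm q x y z (garrettA q) k -
      C (qPochInf w q * β)⁻¹ * qPochInf (X * C w) (C q) * formalTerm q x y z (garrettB q) k := by
    intro k
    rw [← qPochInf_X_mul_C, ← qPochInf_mul_qPoch_inv hq, formalTerm, formalTerm, mul_comm z y, hyz,
      map_one, mul_one, neg_pow X, ← hw]
    have e : C (ε k) = C (qPochInf w q * α)⁻¹ *
        C ((q ^ k.choose 2)⁻¹ * (qPoch w q k * garrettA q (2 * k)) / qPoch q q k) * (-1) ^ k -
        C (qPochInf w q * β)⁻¹ *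
        C ((q ^ k.choose 2)⁻¹ * (qPoch w q k * garrettB q (2 * k)) / qPoch q q k) * (-1) ^ k := by
      have e1 : ((-1) ^ k : ℂ⟦X⟧) = C ((-1) ^ k) := by simp
      rw [e1, ← map_mul, ← map_mul, ← map_mul, ← map_mul, ← map_sub]
      congr 1
      simp only [hε, hH, div_eq_mul_inv, mul_inv]
      ring
    rw [e]
    ring
  -- Both separated series converge formally, so their difference is the sum `S'` of the combined
  -- one.
  have hS'' := (hU.sub hV).unique (hS'.of_eq (fun k => (hterm k).symm) rfl)
  rw [hS'', ← hSS]
  refine hS.of_eq (fun n => ?_) rfl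
  rw [← qPoch_X_eq_tprod, pow_zero, mul_one]

theorem mainTheorem3 (q x y z : ℂ) (hq : ‖q‖ < 1) (hzx : ‖z * x‖ < 1) :
    -- the representation by `₁φ₂`
    (∀ a : ℂ, (∀ k : ℕ, a * z * x * q ^ k ≠ 1) →
      Summable (basicHypergeometricTerm [a] [a * z * x, 0] q (q * y * z)) ∧
      HasSum (fun n : ℕ => stieltjesWigert n x y q * (qPoch a q n / qPoch q q n) * z ^ n)
        (qPochInf (a * z * x) q / qPochInf (z * x) q *
          basicHypergeometric [a] [a * z * x, 0] q (q * y * z))) ∧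
    (q ≠ 0 → y * z = 1 →
      -- the expansion in Garrett's polynomials, for complex `a`
      (∀ a : ℂ, (∀ k : ℕ, a * z * x * q ^ k ≠ 1) →
        ∃ T : ℂ,
          HasSum (fun k : ℕ =>
            (q ^ k.choose 2)⁻¹ * (qPoch (z * x) q k / (qPoch (a * z * x) q k * qPoch q q k)) *
              (-(a * z * y)) ^ k *
              (garrettA q (2 * k) / (qPochInf q (q ^ 5) * qPochInf (q ^ 4) (q ^ 5)) -
                garrettB q (2 * k) / (qPochInf (q ^ 2) (q ^ 5) * qPochInf (q ^ 3) (q ^ 5)))) T ∧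
          HasSum (fun n : ℕ => stieltjesWigert n x y q * (qPoch a q n / qPoch q q n) * z ^ n)
            (qPochInf (a * z * x) q / qPochInf (z * x) q * T)) ∧
      -- the expansion as a difference of two series, for formal `a = X`, in `ℂ⟦X⟧`
      ∃ U V : ℂ⟦X⟧,
        HasSum (formalTerm q x y z (garrettA q)) U ∧
        HasSum (formalTerm q x y z (garrettB q)) V ∧
        HasSum (fun n : ℕ =>
            PowerSeries.C (stieltjesWigert n x y q / qPoch q q n * z ^ n) *
              qPoch PowerSeries.X (PowerSeries.C q) n)
          (PowerSeries.C (qPochInf (z * x) q * (qPochInf q (q ^ 5) * qPochInf (q ^ 4) (q ^ 5)))⁻¹ *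
              qPochInf (PowerSeries.X * PowerSeries.C (z * x)) (PowerSeries.C q) * U -
            PowerSeries.C
                (qPochInf (z * x) q * (qPochInf (q ^ 2) (q ^ 5) * qPochInf (q ^ 3) (q ^ 5)))⁻¹ *
              qPochInf (PowerSeries.X * PowerSeries.C (z * x)) (PowerSeries.C q) * V)) := by
  refine ⟨fun a ha => ?_, fun hq0 hyz => ⟨fun a ha =>
    hasSum_stieltjesWigert_garrett hq hzx hq0 hyz ha, _, _,
    (summable_formalTerm q x y z (garrettA q)).hasSum,
    (summable_formalTerm q x y z (garrettB q)).hasSum, hasSum_formal_garrett hq hzx hq0 hyz⟩⟩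
  obtain ⟨h, hs⟩ := hasSum_stieltjesWigert (y := y) hq hzx ha
  simp only [← basicHypergeometricTerm_eq] at h hs
  exact ⟨hs, h⟩
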